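/- Let $L\ge 1$, let $R,V,T\in\mathbb{C}^{L\times L}$ with $R$ and $T$ invertible, and for $E\in\mathbb{C}$ let $$ \mathcal{T}^E=\begin{pmatrix}(E\,\mathbf{1}-V)T^{-1} & -R\\ T^{-1} & 0\end{pmatrix}\in\mathbb{C}^{2L\times 2L} $$ be the transfer matrix. Let $z_1(E),\ldots,z_{2L}(E)$ be its eigenvalues, listed with algebraic multiplicity and ordered such that $|z_1(E)|\le\cdots\le|z_{2L}(E)|$. Assume that the set of those $E\in\mathbb{C}$ for which $\mathcal{T}^E$ has an eigenvalue of algebraic multiplicity at least $2$ is finite. Let $$ \Lambda=\{E\in\mathbb{C}:|z_L(E)|=|z_{L+1}(E)|\}. $$ Then the topological boundary $\partial\Lambda$ of $\Lambda$ in $\mathbb{C}$ is locally a finite union of analytic arcs: every $E\in\partial\Lambda$ has arbitrarily small neighbourhoods $K$ such that $\partial\Lambda\cap K$ is a finite union of analytic arcs. Here an analytic arc is a set $\gamma([0,1])$, where $\gamma$ is a map into $\mathbb{C}$ that is real analytic on a neighbourhood of $[0,1]$, injective on $[0,1]$, and satisfies $\gamma'(t)\neq 0$ for all $t\in(0,1)$.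 -/

import Mathlib

open scoped Topology

noncomputable section

/-- The `2L × 2L` transfer matrix at energy `E` of the block tridiagonal Laurent operator with
`L × L` blocks `R` (below the diagonal), `V` (on the diagonal) and `T` (above the diagonal). It is
only used for invertible `T`. -/
def transferMatrix {L : ℕ} (R V T : Matrix (Fin L) (Fin L) ℂ) (E : ℂ) :
    Matrix (Fin L ⊕ Fin L) (Fin L ⊕ Fin L) ℂ :=
  Matrix.fromBlocks ((E • (1 : Matrix (Fin L) (Fin L) ℂ) - V) * T⁻¹) (-R) T⁻¹ 0

/-- The energies at which the transfer matrix has a degenerate eigenvalue, that is, an eigenvalue of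
algebraic multiplicity at least two. -/
def degenerateEnergies {L : ℕ} (R V T : Matrix (Fin L) (Fin L) ℂ) : Set ℂ :=
  {E | ∃ z : ℂ, 2 ≤ (transferMatrix R V T E).charpoly.rootMultiplicity z}

/-- `z` lists the eigenvalues of the complex matrix `M`, repeated according to algebraic
multiplicity, by non-decreasing modulus. -/
def IsModulusOrderedSpectrum {n : Type*} [Fintype n] [DecidableEq n] (M : Matrix n n ℂ) {k : ℕ}
    (z : Fin k → ℂ) : Prop :=
  (Finset.univ : Finset (Fin k)).val.map z = M.charpoly.roots ∧ Monotone (fun l => ‖z l‖)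

/-- The energies `E` at which the two middle eigenvalues `z_L(E)` and `z_{L+1}(E)` of the transfer
matrix have the same modulus. Indices start at `0` here, so that `z_L` and `z_{L+1}` are the entries
with index `L - 1` and `L`. (The moduli do not depend on the choice of the ordering `z`.) -/
def middleModulusSet {L : ℕ} (R V T : Matrix (Fin L) (Fin L) ℂ) : Set ℂ :=
  {E | ∃ z : Fin (2 * L) → ℂ, IsModulusOrderedSpectrum (transferMatrix R V T E) z ∧
    ∃ i j : Fin (2 * L), (i : ℕ) + 1 = L ∧ (j : ℕ) = L ∧ ‖z i‖ = ‖z j‖}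

/-- A (compact, simple) analytic arc in the plane: the image of `[0, 1]` under an injective map that
is real analytic on a neighbourhood of `[0, 1]` and has non-vanishing derivative on `(0, 1)`. The
derivative may vanish at an end point, so that the two halves of a cusp are analytic arcs. -/
def IsAnalyticArc (A : Set ℂ) : Prop :=
  ∃ γ : ℝ → ℂ, AnalyticOnNhd ℝ γ (Set.Icc 0 1) ∧ Set.InjOn γ (Set.Icc 0 1) ∧
    (∀ t ∈ Set.Ioo (0 : ℝ) 1, deriv γ t ≠ 0) ∧ A = γ '' Set.Icc 0 1

/-- Every point of `S` has arbitrarily small neighbourhoods in which `S` is a finite union of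
analytic arcs. -/
def IsLocallyFiniteUnionOfAnalyticArcs (S : Set ℂ) : Prop :=
  ∀ x ∈ S, ∀ U ∈ 𝓝 x, ∃ K ∈ 𝓝 x, K ⊆ U ∧
    ∃ 𝒜 : Set (Set ℂ), 𝒜.Finite ∧ (∀ A ∈ 𝒜, IsAnalyticArc A) ∧ S ∩ K = ⋃₀ 𝒜

end

/-!
After a ramified substitution `E = E₀ + w ^ N` the eigenvalues of the transfer matrix near a given
energy `E₀` are analytic functions `F i` of `w`: this is Puiseux's theorem
(`BivariatePolynomial.exists_analytic_roots_comp_pow`). It is proved by covering space theory. Away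
from the finitely many degenerate energies the spectral curve covers the energy plane, so the
eigenvalues lift to single-valued functions on a half plane mapped by `exp` onto a punctured disc;
translation by `2πi` permutes them, so they are periodic, and bounded at the puncture. They do not
vanish, since `R` and `T` are invertible.

Write `Λ` for `middleModulusSet R V T` and `∂Λ` for its frontier. An energy lies outside `Λ` exactly
when some set `S` of `L` indices is separated from its complement
by a gap, `‖F i‖ < ‖F j‖` for `i ∈ S`, `j ∉ S` (`mem_middleModulusSet_iff`). Such an `S` is unique,
so near `w = 0` the complement of `Λ` is a disjoint union of open sets, each of the form
`‖h p‖ < 1` for finitely many nonvanishing analytic functions `h p = F i / F j`, and `∂Λ` is the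
union of their frontiers. For one such set, the frontier near `0` is analysed as follows.

* It is contained in the union of the level sets `‖h p‖ = 1`. Since no `‖h p‖` is identically one
  near a point of the frontier, each level set is covered near `0` by finitely many analytic arcs
  from `0`: it is empty, or given by `Re (φ ^ k) = 0` in a suitable local coordinate `φ`
  (`exists_finite_cover_norm_eq_one`).
* Near `0`, each of these arcs belongs to the frontier either entirely or not at all
  (`exists_forall_mem_frontier_or_forall_notMem`). By Schwarz reflection
  (`exists_norm_eq_one_dichotomy`), in a coordinate that straightens the arc no sign of `‖h p‖ - 1`
  changes off the real axis near a point of the arc where the arc meets the frontier. Hence the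
  intersection of arc and frontier is open and closed in the arc.
* At least one arc belongs to the frontier: by the maximum principle the frontier has no isolated
  points (`not_eventually_notMem_frontier_unitSublevel`).

The map `w ↦ E₀ + w ^ N` is open, hence carries frontiers to frontiers, and it is injective on short
arcs from `0` because the modulus increases along them
(`IsConformalGerm.eventually_isAnalyticArc`).
-/

open scoped Topology

noncomputable section

open Filter Set

/-! ### Level sets of the modulus of an analytic germ -/

/-- A germ at `0` of a conformal map of the plane fixing `0`. Restricted to small nonnegative reals
it parametrizes an analytic arc starting at `0`. -/
structure IsConformalGerm (Ψ : ℂ → ℂ) : Prop where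
  analyticAt : AnalyticAt ℂ Ψ 0
  map_zero : Ψ 0 = 0
  deriv_ne_zero : deriv Ψ 0 ≠ 0

/-- A nonzero analytic germ vanishing at `0` is a power of a local coordinate. -/
theorem exists_eventuallyEq_pow_conformalGerm {g : ℂ → ℂ} (hg : AnalyticAt ℂ g 0) (g0 : g 0 = 0)
    (hne : ¬ ∀ᶠ w in 𝓝 0, g w = 0) :
    ∃ k : ℕ, k ≠ 0 ∧ ∃ φ : ℂ → ℂ, IsConformalGerm φ ∧ ∀ᶠ w in 𝓝 0, g w = φ w ^ k := by
  have htop : analyticOrderAt g 0 ≠ ⊤ := fun h => hne (analyticOrderAt_eq_top.1 h)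
  obtain ⟨u, hu, u0, hgu⟩ := hg.analyticOrderAt_ne_top.1 htop
  set k := analyticOrderNatAt g 0
  have hk : k ≠ 0 := by
    intro hk
    have := hgu.self_of_nhds
    simp [hk, g0] at this
    exact u0 this.symm
  obtain ⟨c, hc⟩ := IsAlgClosed.exists_pow_nat_eq (u 0) (Nat.pos_of_ne_zero hk)
  have c0 : c ≠ 0 := by rintro rfl; simp [hk] at hc; exact u0 hc.symm
  have hlog : AnalyticAt ℂ (fun w => Complex.log (u w / u 0)) 0 := by
    refine AnalyticAt.clog (hu.div analyticAt_const u0) ?_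
    simp [u0]
  set v : ℂ → ℂ := fun w => c * Complex.exp (Complex.log (u w / u 0) / k)
  have hv : AnalyticAt ℂ v 0 := by
    refine analyticAt_const.mul (AnalyticAt.cexp (hlog.div analyticAt_const ?_))
    exact_mod_cast hk
  have v0 : v 0 = c := by simp [v, u0]
  refine ⟨k, hk, fun w => w * v w, ⟨analyticAt_id.mul hv, by simp, ?_⟩, ?_⟩
  · have := ((hasDerivAt_id (0 : ℂ)).mul hv.differentiableAt.hasDerivAt).deriv
    rw [show (fun w => w * v w) = id * v from rfl, this]
    simpa [v0] using c0
  · filter_upwards [hgu, hu.continuousAt.eventually_ne u0] with w hw huw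
    rw [hw, mul_pow, mul_pow, hc, ← Complex.exp_nat_mul,
      mul_div_cancel₀ _ (by exact_mod_cast hk), Complex.exp_log (div_ne_zero huw u0),
      mul_div_cancel₀ _ u0]
    simp

/-- The analytic local inverse of a conformal germ. -/
theorem IsConformalGerm.exists_leftInverse {φ : ℂ → ℂ} (hφ : IsConformalGerm φ) :
    ∃ ψ : ℂ → ℂ, IsConformalGerm ψ ∧ ∀ᶠ w in 𝓝 0, ψ (φ w) = w := by
  have hs := hφ.analyticAt.hasStrictDerivAt
  have hl := hs.eventually_left_inverse hφ.deriv_ne_zero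
  have h0 := hl.self_of_nhds
  rw [hφ.map_zero] at h0
  have han := hφ.analyticAt.analyticAt_localInverse hφ.deriv_ne_zero
  rw [hφ.map_zero] at han
  refine ⟨_, ⟨han, h0, ?_⟩, hl⟩
  have := (hs.to_localInverse hφ.deriv_ne_zero).hasDerivAt
  rw [hφ.map_zero] at this
  rw [this.deriv]
  exact inv_ne_zero hφ.deriv_ne_zero

theorem IsConformalGerm.comp_const_mul {ψ : ℂ → ℂ} (hψ : IsConformalGerm ψ) {ω : ℂ} (hω : ω ≠ 0) :
    IsConformalGerm (fun u => ψ (ω * u)) := by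
  have hl : HasDerivAt (fun u : ℂ => ω * u) ω 0 := by
    simpa using (hasDerivAt_id (0 : ℂ)).const_mul ω
  have hψ' : HasDerivAt ψ (deriv ψ 0) (ω * 0) := by
    rw [mul_zero]; exact hψ.analyticAt.differentiableAt.hasDerivAt
  refine ⟨AnalyticAt.fun_comp (by rw [mul_zero]; exact hψ.analyticAt)
    (analyticAt_const.mul analyticAt_id), by simp [hψ.map_zero], ?_⟩
  have := (hψ'.comp (0 : ℂ) hl).deriv
  rw [show (fun u => ψ (ω * u)) = ψ ∘ fun u => ω * u from rfl, this]
  exact mul_ne_zero hψ.deriv_ne_zero hω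

/-- Near `0`, the level set `‖h‖ = 1` of an analytic germ is everything or is covered by finitely
many arcs: writing `h = h(0) exp(φ ^ k)` in a local coordinate `φ`, it is the set
`Re (φ ^ k) = 0`, which consists of the `2k` rays `φ ∈ ω ℝ≥0` with `ω ^ (2k) = -1`. -/
theorem exists_finite_cover_norm_eq_one {h : ℂ → ℂ} (hh : AnalyticAt ℂ h 0) (h0 : h 0 ≠ 0) :
    (∀ᶠ w in 𝓝 0, ‖h w‖ = 1) ∨
    ∃ P : Set (ℂ → ℂ), P.Finite ∧ (∀ Ψ ∈ P, IsConformalGerm Ψ) ∧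
      ∀ ε > 0, ∀ᶠ w in 𝓝[≠] 0, ‖h w‖ = 1 → ∃ Ψ ∈ P, ∃ t ∈ Ioo (0 : ℝ) ε, Ψ t = w := by
  by_cases hn : ‖h 0‖ = 1
  swap
  · refine .inr ⟨∅, finite_empty, by simp, fun ε _ => ?_⟩
    filter_upwards [nhdsWithin_le_nhds (hh.continuousAt.norm.eventually_ne hn)] with w hw h1
    exact absurd h1 hw
  set g : ℂ → ℂ := fun w => Complex.log (h w / h 0)
  have hg : AnalyticAt ℂ g 0 := AnalyticAt.clog (hh.div analyticAt_const h0) (by simp [h0])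
  have g0 : g 0 = 0 := by simp [g]
  have hre : ∀ᶠ w in 𝓝 0, (‖h w‖ = 1 ↔ (g w).re = 0) := by
    filter_upwards [hh.continuousAt.eventually_ne h0] with w hw
    have : 0 < ‖h w‖ := norm_pos_iff.2 hw
    simp only [g, Complex.log_re, norm_div, hn, div_one]
    refine ⟨fun h => by simp [h], fun h => Real.eq_one_of_pos_of_log_eq_zero this h⟩
  by_cases hne : ∀ᶠ w in 𝓝 0, g w = 0
  · left
    filter_upwards [hre, hne] with w h1 h2
    rw [h1, h2, Complex.zero_re]
  obtain ⟨k, hk, φ, hφ, hgφ⟩ := exists_eventuallyEq_pow_conformalGerm hg g0 hne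
  obtain ⟨ψ, hψ, hinv⟩ := hφ.exists_leftInverse
  refine .inr ⟨(fun ω u => ψ (ω * u)) '' {ω : ℂ | ω ^ (2 * k) = -1}, ?_, ?_, fun ε hε => ?_⟩
  · refine Set.Finite.image _ ?_
    refine (Polynomial.nthRoots (2 * k) (-1 : ℂ)).toFinset.finite_toSet.subset fun ω hω => ?_
    simp only [Finset.mem_coe, Multiset.mem_toFinset]
    exact (Polynomial.mem_nthRoots (by omega)).2 hω
  · rintro _ ⟨ω, hω, rfl⟩
    refine hψ.comp_const_mul ?_
    rintro rfl
    simp [hk] at hω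
  · have hsmall : ∀ᶠ w in 𝓝 0, ‖φ w‖ < ε := by
      refine hφ.analyticAt.continuousAt.norm.eventually_lt continuousAt_const ?_
      simpa [hφ.map_zero] using hε
    filter_upwards [nhdsWithin_le_nhds hre, nhdsWithin_le_nhds hgφ, nhdsWithin_le_nhds hinv,
      nhdsWithin_le_nhds hsmall, self_mem_nhdsWithin] with w h1 h2 h3 h4 h5 h6
    have hne : φ w ≠ 0 := by
      intro h
      rw [h, hψ.map_zero] at h3
      exact h5 h3.symm
    have hpos : 0 < ‖φ w‖ := norm_pos_iff.2 hne
    have hr : (φ w ^ k).re = 0 := by rw [← h2]; exact h1.1 h6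
    refine ⟨_, ⟨φ w / ‖φ w‖, ?_, rfl⟩, ‖φ w‖, ⟨hpos, h4⟩, ?_⟩
    · have him : ((φ w ^ k).im) ^ 2 = (‖φ w‖ ^ k) ^ 2 := by
        rw [← norm_pow, Complex.sq_norm, Complex.normSq_apply, hr]; ring
      have hsq : (φ w ^ k) ^ 2 = -((‖φ w‖ : ℂ) ^ k) ^ 2 := by
        apply Complex.ext
        · rw [pow_two, Complex.mul_re, hr]
          norm_cast
          rw [← him]; ring
        · rw [pow_two, Complex.mul_im, hr]
          norm_cast
          ring
      have hpc : ((‖φ w‖ : ℂ) ^ k) ^ 2 ≠ 0 := by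
        have : (‖φ w‖ : ℂ) ≠ 0 := by exact_mod_cast hpos.ne'
        positivity
      simp only [mem_ofPred_eq]
      rw [mul_comm 2 k, pow_mul, div_pow, div_pow, hsq, neg_div, div_self hpc]
    · have : (‖φ w‖ : ℂ) ≠ 0 := by exact_mod_cast hpos.ne'
      simp only
      rw [div_mul_cancel₀ _ this, h3]

/-- **Schwarz reflection** at an analytic germ `k` restricted to the real axis: on small positive
reals `‖k‖ = 1` holds always or never, and off the real axis `‖k u‖ = 1` is impossible near small
positive reals unless it holds identically. Where `k` is unimodular on the reals,
`k (conj u) = 1 / conj (k u)`, so `‖k u‖ = 1` forces `k (conj u) = k u`, and `k` is injective near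
points with nonzero derivative. -/
theorem exists_norm_eq_one_dichotomy {k : ℂ → ℂ} (hk : AnalyticAt ℂ k 0) :
    ∃ ε > 0, ((∀ t ∈ Ioo (0 : ℝ) ε, ‖k t‖ = 1) ∨ (∀ t ∈ Ioo (0 : ℝ) ε, ‖k t‖ ≠ 1)) ∧
      ∀ t ∈ Ioo (0 : ℝ) ε, (∀ᶠ u in 𝓝 (t : ℂ), ‖k u‖ = 1) ∨
        ∀ᶠ u in 𝓝 (t : ℂ), ‖k u‖ = 1 → u.im = 0 := by
  -- `m` is complex analytic and equals `‖k t‖ ^ 2 - 1` at real `t`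
  set m : ℂ → ℂ := fun u => k u * starRingEnd ℂ (k (starRingEnd ℂ u)) - 1
  have hm : AnalyticAt ℂ m 0 := by
    refine (hk.mul ?_).sub analyticAt_const
    rw [Complex.analyticAt_iff_eventually_differentiableAt] at hk ⊢
    have : Tendsto (starRingEnd ℂ) (𝓝 0) (𝓝 (0 : ℂ)) := by
      simpa using (Complex.continuous_conj.tendsto (0 : ℂ))
    filter_upwards [this.eventually hk] with z hz
    simpa [Function.comp_def] using hz.conj_conj
  have hmt : ∀ t : ℝ, m t = 0 ↔ ‖k t‖ = 1 := by
    intro t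
    simp only [m, Complex.conj_ofReal, Complex.mul_conj, sub_eq_zero]
    rw [Complex.normSq_eq_norm_sq]
    norm_cast
    exact pow_eq_one_iff_of_nonneg (norm_nonneg _) two_ne_zero
  obtain ⟨r, hr, hkan⟩ := Metric.eventually_nhds_iff.1 hk.eventually_analyticAt
  have hdist : ∀ {r : ℝ}, ∀ t ∈ Ioo (0 : ℝ) r, dist (t : ℂ) 0 < r := by
    intro r t ht
    simpa [abs_of_pos ht.1] using ht.2
  rcases hm.eventually_eq_zero_or_eventually_ne_zero with hz | hnz
  · obtain ⟨r₁, hr₁, hz⟩ := Metric.eventually_nhds_iff.1 hz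
    rcases hk.deriv.eventually_eq_zero_or_eventually_ne_zero with hd | hd
    · -- a germ with vanishing derivative is locally constant
      obtain ⟨r₂, hr₂, hd⟩ := Metric.eventually_nhds_iff.1 hd
      have hunit : ∀ t ∈ Ioo (0 : ℝ) (min r (min r₁ r₂)), ‖k t‖ = 1 := fun t ht =>
        (hmt t).1 (hz (hdist t ⟨ht.1, ht.2.trans_le ((min_le_right _ _).trans (min_le_left _ _))⟩))
      refine ⟨min r (min r₁ r₂), by positivity, .inl hunit, fun t ht => .inl ?_⟩
      have hball : Metric.ball (0 : ℂ) (min r (min r₁ r₂)) ∈ 𝓝 (t : ℂ) :=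
        Metric.isOpen_ball.mem_nhds (hdist t ht)
      filter_upwards [hball] with u hu
      rw [← hunit t ht]
      congr 1
      refine Metric.isOpen_ball.is_const_of_deriv_eq_zero
        (convex_ball (0 : ℂ) (min r (min r₁ r₂))).isPreconnected ?_ ?_ hu (hdist t ht)
      · intro z hz
        exact (hkan (lt_of_lt_of_le hz (min_le_left _ _))).differentiableAt.differentiableWithinAt
      · intro z hz
        exact hd (lt_of_lt_of_le hz ((min_le_right _ _).trans (min_le_right _ _)))
    · obtain ⟨r₂, hr₂, hd⟩ := Metric.eventually_nhds_iff.1 (eventually_nhdsWithin_iff.1 hd)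
      refine ⟨min r (min r₁ r₂), by positivity, .inl fun t ht => (hmt t).1 (hz (hdist t
        ⟨ht.1, ht.2.trans_le ((min_le_right _ _).trans (min_le_left _ _))⟩)), fun t ht => .inr ?_⟩
      have hka := hkan (hdist t ⟨ht.1, ht.2.trans_le (min_le_left _ _)⟩)
      have hd' : deriv k t ≠ 0 := hd (hdist t
        ⟨ht.1, ht.2.trans_le ((min_le_right _ _).trans (min_le_right _ _))⟩)
        (by simpa using ht.1.ne')
      have hl := hka.hasStrictDerivAt.eventually_left_inverse hd'
      have hconj : Tendsto (starRingEnd ℂ) (𝓝 (t : ℂ)) (𝓝 (t : ℂ)) := by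
        simpa using (Complex.continuous_conj.tendsto (t : ℂ))
      have hball : Metric.ball (0 : ℂ) r₁ ∈ 𝓝 (t : ℂ) := Metric.isOpen_ball.mem_nhds
        (hdist t ⟨ht.1, ht.2.trans_le ((min_le_right _ _).trans (min_le_left _ _))⟩)
      filter_upwards [hl, hconj.eventually hl, hball] with u h1 h2 h3 h4
      have h5 : k u * starRingEnd ℂ (k (starRingEnd ℂ u)) = 1 := sub_eq_zero.1 (hz h3)
      have h6 : k u * starRingEnd ℂ (k u) = 1 := by
        rw [Complex.mul_conj, Complex.normSq_eq_norm_sq, h4]; simp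
      have h7 : k u ≠ 0 := by intro h; simp [h] at h5
      have h8 : k (starRingEnd ℂ u) = k u := by
        apply (starRingEnd ℂ).injective
        exact mul_left_cancel₀ h7 (h5.trans h6.symm)
      rw [h8, h1] at h2
      exact Complex.conj_eq_iff_im.1 h2.symm
  · obtain ⟨r₁, hr₁, hnz⟩ := Metric.eventually_nhds_iff.1 (eventually_nhdsWithin_iff.1 hnz)
    have hne : ∀ t ∈ Ioo (0 : ℝ) (min r r₁), ‖k t‖ ≠ 1 := fun t ht h =>
      hnz (hdist t ⟨ht.1, ht.2.trans_le (min_le_right _ _)⟩) (by simpa using ht.1.ne')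
        ((hmt t).2 h)
    refine ⟨min r r₁, by positivity, .inr hne, fun t ht => .inr ?_⟩
    have hka := hkan (hdist t ⟨ht.1, ht.2.trans_le (min_le_left _ _)⟩)
    filter_upwards [hka.continuousAt.norm.eventually_ne (hne t ht)] with u hu h1
    exact absurd h1 hu

/-! ### Frontiers of sublevel sets of finitely many moduli -/

theorem IsPreconnected.subset_of_frontier {X : Type*} [TopologicalSpace X] {s t : Set X}
    (hs : IsPreconnected s) (hst : (s ∩ t).Nonempty) (hf : ∀ x ∈ s, x ∉ frontier t) : s ⊆ t := by
  have h_int : ∀ x ∈ s, x ∈ closure t → x ∈ interior t := fun x hx hc => by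
    by_contra h
    exact hf x hx ⟨hc, h⟩
  refine (hs.subset_of_closure_inter_subset isOpen_interior ?_ ?_).trans interior_subset
  · obtain ⟨x, hx, hxt⟩ := hst
    exact ⟨x, hx, h_int x hx (subset_closure hxt)⟩
  · rintro x ⟨hx, hxs⟩
    exact h_int x hxs (closure_mono interior_subset hx)

theorem isPreconnected_ball_diff_singleton (c : ℂ) (r : ℝ) :
    IsPreconnected (Metric.ball c r \ {c}) := by
  rcases le_or_gt r 0 with hr | hr
  · rw [Metric.ball_eq_empty.2 hr, empty_sdiff]; exact isPreconnected_empty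
  -- the punctured disc is the image of a half plane under the exponential map
  have : Metric.ball c r \ {c} = (fun s => c + Complex.exp s) '' {s : ℂ | s.re < Real.log r} := by
    ext z
    simp only [Set.mem_sdiff, Metric.mem_ball, mem_singleton_iff, mem_image, mem_ofPred_eq]
    constructor
    · rintro ⟨h1, h2⟩
      have h3 : z - c ≠ 0 := sub_ne_zero.2 h2
      refine ⟨Complex.log (z - c), ?_, by rw [Complex.exp_log h3]; ring⟩
      rw [Complex.log_re]
      exact Real.log_lt_log (norm_pos_iff.2 h3) (by rwa [← dist_eq_norm])
    · rintro ⟨s, hs, rfl⟩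
      refine ⟨?_, by simp [Complex.exp_ne_zero]⟩
      rw [dist_eq_norm, add_sub_cancel_left, Complex.norm_exp]
      exact (Real.lt_log_iff_exp_lt hr).1 hs
  rw [this]
  exact (convex_halfSpace_re_lt _).isPreconnected.image _ (by fun_prop)

/-- The set where all members of a family of functions have modulus less than one. -/
def unitSublevel {κ : Type*} (h : κ → ℂ → ℂ) : Set ℂ := {w | ∀ p, ‖h p w‖ < 1}

theorem norm_le_one_of_mem_closure_unitSublevel {κ : Type*} {h : κ → ℂ → ℂ} {w : ℂ} {p : κ}
    (hc : ContinuousAt (h p) w)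
    (hw : w ∈ closure (unitSublevel h)) : ‖h p w‖ ≤ 1 := by
  by_contra! hlt
  obtain ⟨z, hz1, hz2⟩ := mem_closure_iff_nhds.1 hw _
    (continuousAt_const.eventually_lt hc.norm hlt)
  exact lt_asymm hz1 (hz2 p)

section

variable {κ : Type*} [Finite κ] {h : κ → ℂ → ℂ}

theorem unitSublevel_mem_nhds {w : ℂ} (hc : ∀ p, ContinuousAt (h p) w) (hw : w ∈ unitSublevel h) :
    unitSublevel h ∈ 𝓝 w :=
  eventually_all.2 fun p => (hc p).norm.eventually_lt continuousAt_const (hw p)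

theorem exists_norm_eq_one_of_mem_frontier_unitSublevel {w : ℂ} (hc : ∀ p, ContinuousAt (h p) w)
    (hw : w ∈ frontier (unitSublevel h)) : ∃ p, ‖h p w‖ = 1 := by
  by_contra! hne
  refine hw.2 (mem_interior_iff_mem_nhds.2 (unitSublevel_mem_nhds hc fun p => ?_))
  exact lt_of_le_of_ne (norm_le_one_of_mem_closure_unitSublevel (hc p) hw.1) (hne p)

/-- If a point of the frontier lies on an analytic arc along which some `‖h p‖` equals one, then
so do the neighbouring points of the arc: in the coordinate `u` straightening the arc, the
level sets `‖h p (Ψ u)‖ = 1` are contained in the real axis, so that a whole half disc belongs to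
the sublevel set. -/
theorem eventually_mem_frontier_unitSublevel {Ψ : ℂ → ℂ} {t₀ : ℝ}
    (hΨ : AnalyticAt ℂ Ψ t₀) (hΨ' : deriv Ψ t₀ ≠ 0) (hh : ∀ p, AnalyticAt ℂ (h p) (Ψ t₀))
    (hdich : ∀ p, (∀ᶠ u in 𝓝 (t₀ : ℂ), ‖h p (Ψ u)‖ = 1) ∨
      ∀ᶠ u in 𝓝 (t₀ : ℂ), ‖h p (Ψ u)‖ = 1 → u.im = 0)
    (hreal : ∀ᶠ t : ℝ in 𝓝 t₀, ∃ p, ‖h p (Ψ t)‖ = 1)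
    (hmem : Ψ t₀ ∈ closure (unitSublevel h)) :
    ∀ᶠ t : ℝ in 𝓝 t₀, Ψ t ∈ frontier (unitSublevel h) := by
  have hfreq : ∃ᶠ u in 𝓝 (t₀ : ℂ), Ψ u ∈ unitSublevel h := by
    rw [mem_closure_iff_frequently, ← hΨ.hasStrictDerivAt.map_nhds_eq hΨ'] at hmem
    exact frequently_map.1 hmem
  -- a modulus identically one near the point would keep the sublevel set away from it
  have hoff : ∀ p, ∀ᶠ u in 𝓝 (t₀ : ℂ), ‖h p (Ψ u)‖ = 1 → u.im = 0 := by
    intro p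
    refine (hdich p).resolve_left fun hp => ?_
    obtain ⟨u, hu1, hu2⟩ := (hfreq.and_eventually hp).exists
    exact (hu1 p).ne hu2
  have hre : Tendsto Complex.re (𝓝 (t₀ : ℂ)) (𝓝 t₀) := Complex.continuous_re.tendsto' _ _ (by simp)
  have hcont : ∀ p, ∀ᶠ u in 𝓝 (t₀ : ℂ), ContinuousAt (fun u => h p (Ψ u)) u := fun p =>
    ((hh p).fun_comp hΨ).eventually_analyticAt.mono fun _ hu => hu.continuousAt
  obtain ⟨δ, hδ, hball⟩ := Metric.eventually_nhds_iff_ball.1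
    ((eventually_all.2 hoff).and ((hre.eventually hreal).and ((eventually_all.2 hcont).and
      (hΨ.eventually_analyticAt.mono fun _ hu => hu.continuousAt))))
  obtain ⟨u, huU, hu⟩ := (hfreq.and_eventually (Metric.ball_mem_nhds _ hδ)).exists
  have him : u.im ≠ 0 := by
    intro h0
    obtain ⟨p, hp⟩ := (hball u hu).2.1
    have : (u.re : ℂ) = u := Complex.ext (by simp) (by simp [h0])
    rw [this] at hp
    exact (huU p).ne hp
  -- the half disc on the side of `u`
  set V : Set ℂ := Metric.ball (t₀ : ℂ) δ ∩ {v | 0 < v.im * u.im} with hV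
  have hVconv : Convex ℝ V := by
    refine (convex_ball _ _).inter (convex_halfSpace_gt (f := fun v : ℂ => v.im * u.im) ?_ 0)
    exact ⟨fun x y => by simp [add_mul], fun c x => by simp [mul_assoc]⟩
  have hVU : ∀ v ∈ V, Ψ v ∈ unitSublevel h := by
    intro v hv p
    by_contra! hle
    have hco : ContinuousOn (fun v => ‖h p (Ψ v)‖) V := fun z hz =>
      ((hball z hz.1).2.2.1 p).norm.continuousWithinAt
    obtain ⟨z, hz, hz1⟩ := hVconv.isPreconnected.intermediate_value
      (show u ∈ V from ⟨hu, mul_self_pos.2 him⟩) hv hco ⟨(huU p).le, hle⟩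
    have := (hball z hz.1).1 p hz1
    have h2 := hz.2
    simp [this] at h2
  have hof : Tendsto (fun t : ℝ => (t : ℂ)) (𝓝 t₀) (𝓝 (t₀ : ℂ)) :=
    Complex.continuous_ofReal.tendsto _
  filter_upwards [hof (Metric.ball_mem_nhds _ hδ)] with t ht
  have hlim : Tendsto (fun s : ℝ => (t : ℂ) + s * u.im * Complex.I) (𝓝[>] 0) (𝓝 (t : ℂ)) := by
    have : Continuous (fun s : ℝ => (t : ℂ) + s * u.im * Complex.I) := by fun_prop
    exact (this.tendsto' 0 _ (by simp)).mono_left nhdsWithin_le_nhds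
  refine ⟨mem_closure_of_tendsto ((hball t ht).2.2.2.tendsto.comp hlim) ?_, fun h_int => ?_⟩
  · filter_upwards [hlim (Metric.isOpen_ball.mem_nhds ht), self_mem_nhdsWithin] with s hs1 hs2
    refine hVU _ ⟨hs1, ?_⟩
    simp only [mem_ofPred_eq, Complex.add_im, Complex.ofReal_im, Complex.mul_I_im, zero_add]
    rw [← Complex.ofReal_mul, Complex.ofReal_re, mul_assoc]
    exact mul_pos hs2 (mul_self_pos.2 him)
  · obtain ⟨p, hp⟩ := (hball t ht).2.1
    rw [Complex.ofReal_re] at hp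
    exact (interior_subset h_int p).ne hp

/-- An analytic arc starting at `0` is, near `0`, either contained in the frontier of a sublevel
set or disjoint from it: by `eventually_mem_frontier_unitSublevel` its intersection with the
frontier is open and closed in the arc. -/
theorem exists_forall_mem_frontier_or_forall_notMem (hh : ∀ p, AnalyticAt ℂ (h p) 0)
    {Ψ : ℂ → ℂ} (hΨ : IsConformalGerm Ψ) :
    ∃ ε > 0, (∀ t ∈ Ioo (0 : ℝ) ε, Ψ t ∈ frontier (unitSublevel h)) ∨
      ∀ t ∈ Ioo (0 : ℝ) ε, Ψ t ∉ frontier (unitSublevel h) := by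
  have hcomp : ∀ p, AnalyticAt ℂ (fun u => h p (Ψ u)) 0 := fun p =>
    AnalyticAt.fun_comp (by rw [hΨ.map_zero]; exact hh p) hΨ.analyticAt
  choose e he hdich using fun p => exists_norm_eq_one_dichotomy (hcomp p)
  have hev : ∀ᶠ u in 𝓝 (0 : ℂ), AnalyticAt ℂ Ψ u ∧ deriv Ψ u ≠ 0 ∧
      ∀ p, AnalyticAt ℂ (h p) (Ψ u) := by
    refine hΨ.analyticAt.eventually_analyticAt.and
      ((hΨ.analyticAt.deriv.continuousAt.eventually_ne hΨ.deriv_ne_zero).and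
        (eventually_all.2 fun p => ?_))
    refine hΨ.analyticAt.continuousAt.tendsto.eventually ?_
    rw [hΨ.map_zero]
    exact (hh p).eventually_analyticAt
  have hof : Tendsto (fun t : ℝ => (t : ℂ)) (𝓝[>] 0) (𝓝 0) :=
    (Complex.continuous_ofReal.tendsto' 0 0 (by simp)).mono_left nhdsWithin_le_nhds
  have hall := (hof.eventually hev).and (eventually_all.2 fun p =>
    (Ioo_mem_nhdsGT (he p) : ∀ᶠ t : ℝ in 𝓝[>] 0, t ∈ Ioo 0 (e p)))
  obtain ⟨ε, hε, hall⟩ := mem_nhdsGT_iff_exists_Ioo_subset.1 hall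
  refine ⟨ε, hε, ?_⟩
  by_contra! hcon
  obtain ⟨⟨t₂, ht₂, hn₂⟩, t₁, ht₁, hm₁⟩ := hcon
  -- the set of parameters in the frontier is open, by reflection, and relatively closed
  set A : Set ℝ := {t | t ∈ Ioo 0 ε ∧ Ψ t ∈ frontier (unitSublevel h)} with hA
  have hAopen : IsOpen A := by
    rw [isOpen_iff_mem_nhds]
    rintro t₀ ⟨ht₀, hf⟩
    obtain ⟨⟨h1, h2, h3⟩, h4⟩ := hall ht₀
    obtain ⟨p, hp⟩ := exists_norm_eq_one_of_mem_frontier_unitSublevel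
      (fun p => (h3 p).continuousAt) hf
    have hp' := (hdich p).1.resolve_right fun hno => hno t₀ (h4 p) hp
    refine Filter.Eventually.and (Ioo_mem_nhds ht₀.1 ht₀.2)
      (eventually_mem_frontier_unitSublevel h1 h2 h3 (fun q => (hdich q).2 t₀ (h4 q)) ?_ hf.1)
    filter_upwards [Ioo_mem_nhds ht₀.1 ht₀.2] with t ht
    exact ⟨p, hp' t ((hall ht).2 p)⟩
  have hsub : Ioo 0 ε ⊆ A := by
    refine isPreconnected_Ioo.subset_of_closure_inter_subset hAopen ⟨t₁, ht₁, ht₁, hm₁⟩ ?_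
    rintro t ⟨htc, ht⟩
    refine ⟨ht, ?_⟩
    have hc : ContinuousAt (fun t : ℝ => Ψ t) t :=
      (hall ht).1.1.continuousAt.comp Complex.continuous_ofReal.continuousAt
    rw [← isClosed_frontier.closure_eq]
    refine mem_closure_iff_frequently.2 ?_
    exact hc.tendsto.frequently ((mem_closure_iff_frequently.1 htc).mono fun s hs => hs.2)
  exact hn₂ (hsub ht₂).2

/-- The frontier of a sublevel set has no isolated points, by the maximum principle: otherwise a
punctured disc would be contained in the sublevel set while some `‖h p‖` equals one at its
centre. -/
theorem not_eventually_notMem_frontier_unitSublevel (hh : ∀ p, AnalyticAt ℂ (h p) 0)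
    (h0 : 0 ∈ frontier (unitSublevel h)) :
    ¬ ∀ᶠ w in 𝓝[≠] 0, w ∉ frontier (unitSublevel h) := by
  intro hiso
  obtain ⟨p, hp⟩ := exists_norm_eq_one_of_mem_frontier_unitSublevel
    (fun p => (hh p).continuousAt) h0
  obtain ⟨r, hr, hball⟩ := Metric.eventually_nhds_iff_ball.1 (eventually_nhdsWithin_iff.1 hiso)
  have hsub : Metric.ball 0 r \ {0} ⊆ unitSublevel h := by
    refine (isPreconnected_ball_diff_singleton 0 r).subset_of_frontier ?_
      fun w hw => hball w hw.1 hw.2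
    obtain ⟨w, hw1, hw2⟩ := mem_closure_iff_nhds.1 h0.1 _ (Metric.ball_mem_nhds 0 hr)
    refine ⟨w, ⟨hw1, ?_⟩, hw2⟩
    rintro rfl
    exact (hw2 p).ne hp
  have hmax : IsLocalMax (norm ∘ h p) 0 := by
    filter_upwards [Metric.ball_mem_nhds 0 hr] with w hw
    by_cases hw0 : w = 0
    · rw [hw0]
    · simp only [Function.comp, hp]
      exact (hsub ⟨hw, hw0⟩ p).le
  have hconst := Complex.eventually_eq_of_isLocalMax_norm
    ((hh p).eventually_analyticAt.mono fun _ hz => hz.differentiableAt) hmax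
  obtain ⟨w, ⟨hw1, hw2⟩, hw3⟩ := (((eventually_nhdsWithin_of_eventually_nhds hconst).and
    (eventually_nhdsWithin_of_eventually_nhds (Metric.ball_mem_nhds 0 hr))).and
      (self_mem_nhdsWithin : ({0}ᶜ : Set ℂ) ∈ 𝓝[≠] 0)).exists
  have := hsub ⟨hw2, hw3⟩ p
  rw [hw1, hp] at this
  exact lt_irrefl _ this

/-- Near `0`, and disregarding the point `0` itself, the set `s` is a finite nonempty union of
analytic arcs that start at `0` and are restrictions of conformal germs to the positive reals. The
arcs may be cut off at any small parameter `ε`. -/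
def IsFiniteUnionOfConformalArcsAtZero (s : Set ℂ) : Prop :=
  ∃ P : Set (ℂ → ℂ), P.Finite ∧ P.Nonempty ∧
    (∀ Ψ ∈ P, IsConformalGerm Ψ ∧ ∀ᶠ t : ℝ in 𝓝[>] 0, Ψ t ∈ s) ∧
    ∀ ε > 0, ∀ᶠ w in 𝓝[≠] 0, w ∈ s → ∃ Ψ ∈ P, ∃ t ∈ Ioo (0 : ℝ) ε, Ψ t = w

theorem isFiniteUnionOfConformalArcsAtZero_frontier_unitSublevel
    (hh : ∀ p, AnalyticAt ℂ (h p) 0) (hne : ∀ p, h p 0 ≠ 0)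
    (h0 : 0 ∈ frontier (unitSublevel h)) :
    IsFiniteUnionOfConformalArcsAtZero (frontier (unitSublevel h)) := by
  have hnot : ∀ p, ¬ ∀ᶠ w in 𝓝 0, ‖h p w‖ = 1 := by
    intro p hp
    obtain ⟨w, hw1, hw2⟩ := mem_closure_iff_nhds.1 h0.1 _ hp
    exact (hw2 p).ne hw1
  choose P hPfin hPconf hPcov using fun p =>
    (exists_finite_cover_norm_eq_one (hh p) (hne p)).resolve_left (hnot p)
  set F := frontier (unitSublevel h)
  set Q : Set (ℂ → ℂ) := {Ψ ∈ ⋃ p, P p | ∀ᶠ t : ℝ in 𝓝[>] 0, Ψ t ∈ F}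
  have hfin : (⋃ p, P p).Finite := finite_iUnion hPfin
  have hconf : ∀ Ψ ∈ ⋃ p, P p, IsConformalGerm Ψ := fun Ψ hΨ => by
    obtain ⟨p, hp⟩ := mem_iUnion.1 hΨ
    exact hPconf p Ψ hp
  have hcov : ∀ ε > 0, ∀ᶠ w in 𝓝[≠] 0, w ∈ F → ∃ Ψ ∈ Q, ∃ t ∈ Ioo (0 : ℝ) ε, Ψ t = w := by
    intro ε hε
    -- short pieces of the discarded arcs do not meet the frontier
    have hoff : ∀ᶠ e : ℝ in 𝓝[>] 0, ∀ Ψ ∈ ⋃ p, P p, Ψ ∉ Q → ∀ t ∈ Ioo 0 e, Ψ t ∉ F := by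
      rw [eventually_all_finite hfin]
      intro Ψ hΨ
      obtain ⟨e, he, hon | hoff⟩ := exists_forall_mem_frontier_or_forall_notMem hh (hconf Ψ hΨ)
      · exact .of_forall fun _ hQ => absurd
          ⟨hΨ, mem_of_superset (Ioo_mem_nhdsGT he) hon⟩ hQ
      · filter_upwards [Ioo_mem_nhdsGT he] with e' he' _ t ht
        exact hoff t ⟨ht.1, ht.2.trans he'.2⟩
    obtain ⟨e, he1, he2⟩ := (hoff.and (Ioo_mem_nhdsGT hε)).exists
    have hcont : ∀ᶠ w in 𝓝 (0 : ℂ), ∀ p, ContinuousAt (h p) w := eventually_all.2 fun p =>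
      (hh p).eventually_analyticAt.mono fun _ hz => hz.continuousAt
    filter_upwards [eventually_all.2 fun p => hPcov p e he2.1,
      eventually_nhdsWithin_of_eventually_nhds hcont] with w hw1 hw2 hw3
    obtain ⟨p, hp⟩ := exists_norm_eq_one_of_mem_frontier_unitSublevel hw2 hw3
    obtain ⟨Ψ, hΨ, t, ht, rfl⟩ := hw1 p hp
    have hΨ' := mem_iUnion.2 ⟨p, hΨ⟩
    refine ⟨Ψ, ?_, t, ⟨ht.1, ht.2.trans he2.2⟩, rfl⟩
    by_contra hQ
    exact he1 Ψ hΨ' hQ t ht hw3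
  refine ⟨Q, hfin.subset fun Ψ hΨ => hΨ.1, ?_, fun Ψ hΨ => ⟨hconf Ψ hΨ.1, hΨ.2⟩, hcov⟩
  by_contra hempty
  rw [not_nonempty_iff_eq_empty] at hempty
  refine not_eventually_notMem_frontier_unitSublevel hh h0 ?_
  filter_upwards [hcov 1 one_pos] with w hw hwF
  obtain ⟨Ψ, hΨ, -⟩ := hw hwF
  rw [hempty] at hΨ
  exact hΨ

end

/-! ### Frontiers of sets where moduli have no gap -/

theorem eventually_mem_frontier_iff {X : Type*} [TopologicalSpace X] {x : X} {s t : Set X}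
    (h : ∀ᶠ y in 𝓝 x, (y ∈ s ↔ y ∈ t)) : ∀ᶠ y in 𝓝 x, (y ∈ frontier s ↔ y ∈ frontier t) := by
  filter_upwards [eventually_eventually_nhds.2 h] with y hy
  have hc : y ∈ closure s ↔ y ∈ closure t := by
    simp only [mem_closure_iff_frequently]
    exact frequently_congr hy
  have hi : y ∈ interior s ↔ y ∈ interior t := by
    simp only [mem_interior_iff_mem_nhds]
    exact eventually_congr hy
  simp only [frontier, Set.mem_sdiff, hc, hi]

theorem mem_frontier_iUnion_iff {X ι : Type*} [TopologicalSpace X] [Finite ι] {U : ι → Set X}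
    {x : X} (hU : ∀ i, x ∈ U i → U i ∈ 𝓝 x) (hdisj : Pairwise (Function.onFun Disjoint U)) :
    x ∈ frontier (⋃ i, U i) ↔ ∃ i, x ∈ frontier (U i) := by
  simp only [frontier, closure_iUnion_of_finite, Set.mem_sdiff, mem_iUnion]
  constructor
  · rintro ⟨⟨i, hi⟩, h⟩
    exact ⟨i, hi, fun hi' => h (interior_mono (subset_iUnion U i) hi')⟩
  · rintro ⟨i, hi, h⟩
    refine ⟨⟨i, hi⟩, fun h_int => ?_⟩
    obtain ⟨j, hj⟩ := mem_iUnion.1 (interior_subset h_int)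
    have hj' := hU j hj
    obtain ⟨y, hy1, hy2⟩ := mem_closure_iff_nhds.1 hi _ hj'
    have hij : i = j := by
      by_contra hne
      exact Set.disjoint_left.1 (hdisj hne) hy2 hy1
    subst hij
    exact h (mem_interior_iff_mem_nhds.2 hj')

theorem IsFiniteUnionOfConformalArcsAtZero.congr {s t : Set ℂ}
    (hs : IsFiniteUnionOfConformalArcsAtZero s) (hst : ∀ᶠ w in 𝓝 0, (w ∈ s ↔ w ∈ t)) :
    IsFiniteUnionOfConformalArcsAtZero t := by
  obtain ⟨P, hP, hne, hon, hcov⟩ := hs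
  refine ⟨P, hP, hne, fun Ψ hΨ => ⟨(hon Ψ hΨ).1, ?_⟩, fun ε hε => ?_⟩
  · have hlim : Tendsto (fun t : ℝ => Ψ t) (𝓝[>] 0) (𝓝 0) := by
      have : ContinuousAt (fun t : ℝ => Ψ t) 0 :=
        ContinuousAt.comp (by simpa using (hon Ψ hΨ).1.analyticAt.continuousAt)
          Complex.continuous_ofReal.continuousAt
      have h := this.tendsto
      simp only [Complex.ofReal_zero, (hon Ψ hΨ).1.map_zero] at h
      exact h.mono_left nhdsWithin_le_nhds
    filter_upwards [(hon Ψ hΨ).2, hlim.eventually hst] with t h1 h2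
    exact h2.1 h1
  · filter_upwards [hcov ε hε, eventually_nhdsWithin_of_eventually_nhds hst] with w h1 h2 h3
    exact h1 (h2.2 h3)

/-- A finite union of germs of sets, each of which either does not accumulate at `0` or is a finite
union of arcs there. -/
theorem IsFiniteUnionOfConformalArcsAtZero.iUnion {ι : Type*} [Finite ι] {s : ι → Set ℂ}
    (hs : ∀ i, IsFiniteUnionOfConformalArcsAtZero (s i) ∨ ∀ᶠ w in 𝓝 0, w ∉ s i)
    (hne : ∃ i, IsFiniteUnionOfConformalArcsAtZero (s i)) :
    IsFiniteUnionOfConformalArcsAtZero (⋃ i, s i) := by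
  have : ∀ i, ∃ P : Set (ℂ → ℂ), P.Finite ∧ (IsFiniteUnionOfConformalArcsAtZero (s i) →
      P.Nonempty) ∧ (∀ Ψ ∈ P, IsConformalGerm Ψ ∧ ∀ᶠ t : ℝ in 𝓝[>] 0, Ψ t ∈ s i) ∧
      ∀ ε > 0, ∀ᶠ w in 𝓝[≠] 0, w ∈ s i → ∃ Ψ ∈ P, ∃ t ∈ Ioo (0 : ℝ) ε, Ψ t = w := by
    intro i
    by_cases h : IsFiniteUnionOfConformalArcsAtZero (s i)
    · obtain ⟨P, h1, h2, h3⟩ := h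
      exact ⟨P, h1, fun _ => h2, h3⟩
    · refine ⟨∅, finite_empty, fun h' => absurd h' h, by simp, fun ε _ => ?_⟩
      filter_upwards [eventually_nhdsWithin_of_eventually_nhds ((hs i).resolve_left h)] with w h1 h2
      exact absurd h2 h1
  choose P hfin hPne hon hcov using this
  refine ⟨⋃ i, P i, finite_iUnion hfin, ?_, ?_, fun ε hε => ?_⟩
  · obtain ⟨i, hi⟩ := hne
    exact (hPne i hi).mono (subset_iUnion P i)
  · intro Ψ hΨ
    obtain ⟨i, hi⟩ := mem_iUnion.1 hΨ
    exact ⟨(hon i Ψ hi).1, (hon i Ψ hi).2.mono fun t ht => mem_iUnion.2 ⟨i, ht⟩⟩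
  · filter_upwards [eventually_all.2 fun i => hcov i ε hε] with w hw hws
    obtain ⟨i, hi⟩ := mem_iUnion.1 hws
    obtain ⟨Ψ, hΨ, h⟩ := hw i hi
    exact ⟨Ψ, mem_iUnion.2 ⟨i, hΨ⟩, h⟩

/-- The condition that the moduli of `v` have a gap separating exactly the indices in `S` from the
others. -/
def HasGapAt {ι : Type*} (v : ι → ℂ) (S : Finset ι) : Prop := ∀ i ∈ S, ∀ j ∉ S, ‖v i‖ < ‖v j‖

/-- A set of a given size that is separated by a gap is unique. -/
theorem HasGapAt.eq {ι : Type*} {v : ι → ℂ} {S S' : Finset ι} (h : HasGapAt v S)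
    (h' : HasGapAt v S') (hc : S.card = S'.card) : S = S' := by
  by_contra hne
  obtain ⟨i, hi, hi'⟩ := Finset.not_subset.1 fun hs => hne (Finset.eq_of_subset_of_card_le hs hc.ge)
  obtain ⟨j, hj, hj'⟩ := Finset.not_subset.1 fun hs =>
    hne (Finset.eq_of_subset_of_card_le hs hc.le).symm
  exact lt_asymm (h i hi j hj') (h' j hj i hi')

/-- Let `M` be the set where the moduli of finitely many nonvanishing analytic germs have no gap
after the `n` smallest ones. If `0` is in the frontier of `M`, this frontier is near `0` a finite
union of analytic arcs. -/
theorem isFiniteUnionOfConformalArcsAtZero_frontier_of_gap {ι : Type*} [Finite ι]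
    {F : ι → ℂ → ℂ} (hF : ∀ i, AnalyticAt ℂ (F i) 0) (hne : ∀ i, F i 0 ≠ 0) (n : ℕ) {M : Set ℂ}
    (hM : ∀ᶠ w in 𝓝 0, (w ∉ M ↔ ∃ S : Finset ι, S.card = n ∧ HasGapAt (fun i => F i w) S))
    (h0 : 0 ∈ frontier M) : IsFiniteUnionOfConformalArcsAtZero (frontier M) := by
  let κ (S : {S : Finset ι // S.card = n}) := {p : ι × ι // p.1 ∈ S.1 ∧ p.2 ∉ S.1}
  let h (S) (p : κ S) (w : ℂ) : ℂ := F p.1.1 w / F p.1.2 w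
  have hh : ∀ S p, AnalyticAt ℂ (h S p) 0 := fun S p => (hF _).div (hF _) (hne _)
  have hh0 : ∀ S p, h S p 0 ≠ 0 := fun S p => div_ne_zero (hne _) (hne _)
  let V : Set ℂ := {w | ∀ i, F i w ≠ 0}
  have hV : V ∈ 𝓝 0 := eventually_all.2 fun i => (hF i).continuousAt.eventually_ne (hne i)
  -- off `V` some quotients `h S p` take the junk value `x / 0 = 0`
  let U (S) : Set ℂ := unitSublevel (h S) ∩ V
  have hgap : ∀ S, ∀ w ∈ V, (w ∈ unitSublevel (h S) ↔ HasGapAt (fun i => F i w) S.1) := by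
    intro S w hw
    have key : ∀ p : κ S, ‖h S p w‖ < 1 ↔ ‖F p.1.1 w‖ < ‖F p.1.2 w‖ := fun p => by
      simp only [h, norm_div]
      rw [div_lt_one (norm_pos_iff.2 (hw _))]
    exact ⟨fun hs i hi j hj => (key ⟨(i, j), hi, hj⟩).1 (hs _),
      fun hs p => (key p).2 (hs _ p.2.1 _ p.2.2)⟩
  have hfS : ∀ S, ∀ᶠ w in 𝓝 0, (w ∈ frontier (unitSublevel (h S)) ↔ w ∈ frontier (U S)) := by
    intro S
    refine eventually_mem_frontier_iff ?_
    filter_upwards [hV] with w hw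
    exact ⟨fun h => ⟨h, hw⟩, fun h => h.1⟩
  have hdisj : Pairwise (Function.onFun Disjoint U) := by
    intro S S' hSS'
    refine Set.disjoint_left.2 fun w hw hw' => hSS' (Subtype.ext ?_)
    exact ((hgap S w hw.2).1 hw.1).eq ((hgap S' w hw.2).1 hw'.1) (S.2.trans S'.2.symm)
  have hUopen : ∀ᶠ w in 𝓝 0, ∀ S, w ∈ U S → U S ∈ 𝓝 w := by
    refine eventually_all.2 fun S => ?_
    have hc : ∀ᶠ w in 𝓝 (0 : ℂ), ∀ p, ContinuousAt (h S p) w := eventually_all.2 fun p =>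
      (hh S p).eventually_analyticAt.mono fun _ hz => hz.continuousAt
    filter_upwards [hc, eventually_mem_nhds_iff.2 hV] with w h1 h2 h3
    exact inter_mem (unitSublevel_mem_nhds h1 h3.1) h2
  have hfM : ∀ᶠ w in 𝓝 0, (w ∈ ⋃ S, frontier (unitSublevel (h S)) ↔ w ∈ frontier M) := by
    have h1 : ∀ᶠ w in 𝓝 0, (w ∈ Mᶜ ↔ w ∈ ⋃ S, U S) := by
      filter_upwards [hM, hV] with w hw hwV
      rw [mem_compl_iff, hw, mem_iUnion]
      exact ⟨fun ⟨S, hS, hS'⟩ => ⟨⟨S, hS⟩, (hgap ⟨S, hS⟩ w hwV).2 hS', hwV⟩,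
        fun ⟨S, hS⟩ => ⟨S.1, S.2, (hgap S w hwV).1 hS.1⟩⟩
    filter_upwards [eventually_mem_frontier_iff h1, hUopen, eventually_all.2 hfS] with w h2 h3 h4
    rw [frontier_compl] at h2
    rw [h2, mem_frontier_iUnion_iff h3 hdisj, mem_iUnion]
    exact exists_congr h4
  refine IsFiniteUnionOfConformalArcsAtZero.congr (.iUnion (fun S => ?_) ?_) hfM
  · by_cases hS : 0 ∈ frontier (unitSublevel (h S))
    · exact .inl (isFiniteUnionOfConformalArcsAtZero_frontier_unitSublevel (hh S) (hh0 S) hS)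
    · exact .inr (isClosed_frontier.isOpen_compl.mem_nhds hS)
  · obtain ⟨S, hS⟩ := mem_iUnion.1 (hfM.self_of_nhds.2 h0)
    exact ⟨S, isFiniteUnionOfConformalArcsAtZero_frontier_unitSublevel (hh S) (hh0 S) hS⟩

/-! ### The plane curve of a bivariate polynomial as a covering space -/

namespace BivariatePolynomial

open Polynomial

/-- The polynomial in the second variable obtained from the bivariate polynomial `Q` by
specializing the first variable to `E`. -/
def fiber (Q : ℂ[X][X]) (E : ℂ) : ℂ[X] := Q.map (evalRingHom E)

/-- The affine plane curve `Q(E, z) = 0`. -/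
def curve (Q : ℂ[X][X]) : Set (ℂ × ℂ) := {x | (fiber Q x.1).eval x.2 = 0}

/-- The values of the first variable over which all roots of `Q` are simple. -/
def simpleLocus (Q : ℂ[X][X]) : Set ℂ := {E | ∀ z, (fiber Q E).rootMultiplicity z ≤ 1}

theorem eval_fiber (Q : ℂ[X][X]) (E z : ℂ) : (fiber Q E).eval z =
    ∑ k ∈ Finset.range (Q.natDegree + 1), (Q.coeff k).eval E * z ^ k := by
  rw [fiber, eval_map, eval₂_eq_sum_range]
  rfl

theorem analyticAt_eval_fiber (Q : ℂ[X][X]) (x : ℂ × ℂ) :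
    AnalyticAt ℂ (fun x : ℂ × ℂ => (fiber Q x.1).eval x.2) x := by
  simp only [eval_fiber]
  refine Finset.analyticAt_fun_sum _ fun k _ => ?_
  refine AnalyticAt.mul ?_ (analyticAt_snd.pow k)
  exact (AnalyticAt.aeval_polynomial analyticAt_fst (Q.coeff k))

theorem continuous_eval_fiber (Q : ℂ[X][X]) :
    Continuous (fun x : ℂ × ℂ => (fiber Q x.1).eval x.2) :=
  continuous_iff_continuousAt.2 fun x => (analyticAt_eval_fiber Q x).continuousAt

theorem eval_derivative_ne_zero {Q : ℂ[X][X]} (hQ : Q.Monic) {E z : ℂ} (hE : E ∈ simpleLocus Q)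
    (hz : (fiber Q E).eval z = 0) : (derivative (fiber Q E)).eval z ≠ 0 := by
  intro h
  have := (one_lt_rootMultiplicity_iff_isRoot (hQ.map (evalRingHom E)).ne_zero).2 ⟨hz, h⟩
  exact absurd (hE z) (not_le.2 this)

/-- Near a simple root the curve is the graph of an analytic function. -/
theorem exists_implicitFunction {Q : ℂ[X][X]} {E₁ z₁ : ℂ} (h : (fiber Q E₁).eval z₁ = 0)
    (h' : (derivative (fiber Q E₁)).eval z₁ ≠ 0) :
    ∃ ψ : ℂ → ℂ, AnalyticAt ℂ ψ E₁ ∧ ψ E₁ = z₁ ∧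
      ∀ᶠ v in 𝓝 (E₁, z₁), (v ∈ curve Q ↔ ψ v.1 = v.2) := by
  have han := analyticAt_eval_fiber Q (E₁, z₁)
  set f := fun x : ℂ × ℂ => (fiber Q x.1).eval x.2
  have cdf : ContDiffAt ℂ ⊤ f (E₁, z₁) := han.contDiffAt
  have hd : fderiv ℂ f (E₁, z₁) ((0 : ℂ), (1 : ℂ)) = (derivative (fiber Q E₁)).eval z₁ := by
    have h1 : HasDerivAt (fun z : ℂ => (E₁, z)) ((0 : ℂ), (1 : ℂ)) z₁ :=
      (hasDerivAt_const z₁ E₁).prodMk (hasDerivAt_id z₁)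
    have h2 := han.differentiableAt.hasFDerivAt.comp_hasDerivAt z₁ h1
    exact h2.unique ((fiber Q E₁).hasDerivAt z₁)
  have if₂ : (fderiv ℂ f (E₁, z₁) ∘L .inr ℂ ℂ ℂ).IsInvertible := by
    refine ⟨ContinuousLinearEquiv.unitsEquivAut ℂ (Units.mk0 _ h'), ?_⟩
    ext
    simp [hd]
  refine ⟨cdf.implicitFunction (by simp) if₂, ?_, cdf.implicitFunction_apply_self _ if₂, ?_⟩
  · exact (cdf.contDiffAt_implicitFunction (by simp) if₂).analyticAt
  · filter_upwards [cdf.eventually_apply_eq_iff_implicitFunction (by simp) if₂] with v hv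
    rw [← hv, show f (E₁, z₁) = 0 from h]
    rfl

/-- The projection of the plane curve to the first variable. -/
def proj (Q : ℂ[X][X]) (x : curve Q) : ℂ := x.1.1

theorem continuous_proj (Q : ℂ[X][X]) : Continuous (proj Q) :=
  continuous_fst.comp continuous_subtype_val

/-- The roots of a monic polynomial are bounded locally uniformly in the coefficients. -/
theorem exists_root_bound {Q : ℂ[X][X]} (hQ : Q.Monic) {K : Set ℂ} (hK : IsCompact K) :
    ∃ C : ℝ, ∀ E ∈ K, ∀ z, (fiber Q E).eval z = 0 → ‖z‖ ≤ C := by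
  choose B hB using fun k => hK.exists_bound_of_continuousOn (f := fun E => (Q.coeff k).eval E)
    (Q.coeff k).continuous.continuousOn
  set b : NNReal := (Finset.range Q.natDegree).sup fun k => (B k).toNNReal
  refine ⟨b + 1, fun E hE z hz => ?_⟩
  have hmon : (fiber Q E).Monic := hQ.map _
  have hlt := IsRoot.norm_lt_cauchyBound hmon.ne_zero (a := z) hz
  have hle : (fiber Q E).cauchyBound ≤ b + 1 := by
    rw [cauchyBound, hmon.leadingCoeff, nnnorm_one, div_one]
    gcongr
    rw [show (fiber Q E).natDegree = Q.natDegree from hQ.natDegree_map _]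
    refine Finset.sup_mono_fun fun k _ => ?_
    rw [← NNReal.coe_le_coe]
    refine le_trans ?_ (Real.le_coe_toNNReal _)
    simpa [fiber] using hB k E hE
  exact_mod_cast (hlt.trans_le hle).le

theorem isClosedMap_proj {Q : ℂ[X][X]} (hQ : Q.Monic) : IsClosedMap (proj Q) := by
  refine IsProperMap.isClosedMap (isProperMap_iff_isCompact_preimage.2
    ⟨continuous_proj Q, fun K hK => ?_⟩)
  obtain ⟨C, hC⟩ := exists_root_bound hQ hK
  have hcl : IsClosed (curve Q) := isClosed_eq (continuous_eval_fiber Q) continuous_const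
  refine (hcl.isClosedEmbedding_subtypeVal.isCompact_preimage
    (hK.prod (isCompact_closedBall (0 : ℂ) C))).of_isClosed_subset
      (hK.isClosed.preimage (continuous_proj Q)) fun x hx => ⟨hx, ?_⟩
  rw [mem_closedBall_zero_iff]
  exact hC _ hx _ x.2

theorem isLocalHomeomorphOn_proj {Q : ℂ[X][X]} (hQ : Q.Monic) :
    IsLocalHomeomorphOn (proj Q) (proj Q ⁻¹' simpleLocus Q) := by
  refine IsLocalHomeomorphOn.mk _ _ ?_
  rintro ⟨⟨E₁, z₁⟩, hx⟩ hE
  obtain ⟨ψ, hψ, hψ1, hev⟩ := exists_implicitFunction hx (eval_derivative_ne_zero hQ hE hx)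
  obtain ⟨V, W, hV, hEV, hW, hzW, hVW⟩ := mem_nhds_prod_iff'.1 hev
  have h1 : ∀ᶠ E in 𝓝 E₁, E ∈ V ∧ ContinuousAt ψ E ∧ ψ E ∈ W :=
    Filter.Eventually.and (hV.mem_nhds hEV)
      ((hψ.eventually_analyticAt.mono fun _ h => h.continuousAt).and
        (hψ.continuousAt.eventually_mem (by rw [hψ1]; exact hW.mem_nhds hzW)))
  obtain ⟨V', hV'sub, hV', hEV'⟩ := mem_nhds_iff.1 h1
  have hmem : ∀ E ∈ V', (E, ψ E) ∈ curve Q := fun E hE' =>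
    (hVW (mk_mem_prod (hV'sub hE').1 (hV'sub hE').2.2)).2 rfl
  classical
  refine ⟨⟨⟨⟨proj Q, fun E => if h : E ∈ V' then ⟨(E, ψ E), hmem E h⟩ else ⟨(E₁, z₁), hx⟩,
    {x | x.1.1 ∈ V' ∧ x.1.2 ∈ W}, V', fun x hx => hx.1, ?_, ?_, ?_⟩, ?_, ?_⟩, ?_, hV'⟩,
    ⟨hEV', hzW⟩, fun _ _ => rfl⟩
  · intro E hE'
    simp only [hE', dif_pos]
    exact ⟨hE', (hV'sub hE').2.2⟩
  · rintro ⟨⟨E, z⟩, hz⟩ ⟨hE', hzW'⟩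
    have : ψ E = z := (hVW (mk_mem_prod (hV'sub hE').1 hzW')).1 hz
    simp only at hE'
    simp [proj, hE', this]
  · intro E hE'
    simp [proj, hE']
  · exact (continuous_proj Q).continuousOn
  · rw [Topology.IsInducing.subtypeVal.continuousOn_iff]
    refine ContinuousOn.congr (f := fun E => (E, ψ E)) ?_ ?_
    · exact continuousOn_id.prodMk fun E hE' => (hV'sub hE').2.1.continuousWithinAt
    · intro E hE'
      simp [hE']
  · exact (hV'.preimage (continuous_fst.comp continuous_subtype_val)).inter
      (hW.preimage (continuous_snd.comp continuous_subtype_val))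

/-- Over the locus of simple roots, the plane curve of a monic polynomial is a covering space. -/
theorem isCoveringMapOn_proj {Q : ℂ[X][X]} (hQ : Q.Monic) :
    IsCoveringMapOn (proj Q) (simpleLocus Q) := by
  refine (isClosedMap_proj hQ).isCoveringMapOn_of_isLocalHomeomorphOn (fun E _ => ?_)
    (isLocalHomeomorphOn_proj hQ)
  refine Set.Finite.of_finite_image (f := fun x => x.1.2) ?_ ?_
  · refine (fiber Q E).roots.toFinset.finite_toSet.subset ?_
    rintro _ ⟨⟨⟨E', z⟩, hx⟩, rfl, rfl⟩
    have hne : fiber Q E' ≠ 0 := (hQ.map (evalRingHom E')).ne_zero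
    simpa [proj, mem_roots hne] using show (fiber Q E').eval z = 0 from hx
  · rintro ⟨⟨E₁, z₁⟩, h1⟩ hE₁ ⟨⟨E₂, z₂⟩, h2⟩ hE₂ h
    simp only [mem_preimage, proj, mem_singleton_iff] at hE₁ hE₂ h
    subst hE₁ hE₂ h
    rfl

end BivariatePolynomial

/-! ### Puiseux's theorem -/

namespace BivariatePolynomial

open Polynomial

theorem roots_nodup {Q : ℂ[X][X]} {E : ℂ} (hE : E ∈ simpleLocus Q) : (fiber Q E).roots.Nodup := by
  classical
  rw [Multiset.nodup_iff_count_le_one]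
  intro z
  rw [count_roots]
  exact hE z

theorem card_roots_fiber {Q : ℂ[X][X]} (hQ : Q.Monic) (E : ℂ) :
    (fiber Q E).roots.card = Q.natDegree := by
  rw [IsAlgClosed.card_roots_eq_natDegree]
  exact hQ.natDegree_map _

theorem mem_roots_fiber {Q : ℂ[X][X]} (hQ : Q.Monic) {E z : ℂ} :
    z ∈ (fiber Q E).roots ↔ (fiber Q E).eval z = 0 :=
  mem_roots (hQ.map (evalRingHom E)).ne_zero

theorem roots_fiber_eq_map {Q : ℂ[X][X]} (hQ : Q.Monic) {E : ℂ} {z : Fin Q.natDegree → ℂ}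
    (hz : Function.Injective z) (hroot : ∀ i, (fiber Q E).eval (z i) = 0) :
    (fiber Q E).roots = Finset.univ.val.map z := by
  symm
  refine Multiset.eq_of_le_of_card_le ?_ ?_
  · rw [Multiset.le_iff_subset (Finset.univ.nodup.map hz)]
    intro x hx
    obtain ⟨i, -, rfl⟩ := Multiset.mem_map.1 hx
    exact (mem_roots_fiber hQ).2 (hroot i)
  · simp [card_roots_fiber hQ]

theorem exists_injective_roots {Q : ℂ[X][X]} (hQ : Q.Monic) {E : ℂ} (hE : E ∈ simpleLocus Q) :
    ∃ z : Fin Q.natDegree → ℂ, Function.Injective z ∧ ∀ i, (fiber Q E).eval (z i) = 0 := by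
  have hcard : Fintype.card (fiber Q E).roots.toFinset = Q.natDegree := by
    rw [Fintype.card_coe, Multiset.toFinset_card_of_nodup (roots_nodup hE), card_roots_fiber hQ]
  let e := (Fintype.equivFinOfCardEq hcard).symm
  refine ⟨fun i => (e i).1, fun i j h => e.injective (Subtype.ext h), fun i => ?_⟩
  exact (mem_roots_fiber hQ).1 (Multiset.mem_toFinset.1 (e i).2)

/-- A continuous choice of simple roots is analytic. -/
theorem differentiableAt_of_continuousAt_root {Q : ℂ[X][X]} (hQ : Q.Monic) {e f : ℂ → ℂ} {s : ℂ}
    (he : DifferentiableAt ℂ e s) (hes : e s ∈ simpleLocus Q) (hf : ContinuousAt f s)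
    (hroot : ∀ᶠ t in 𝓝 s, (fiber Q (e t)).eval (f t) = 0) : DifferentiableAt ℂ f s := by
  have h0 := hroot.self_of_nhds
  obtain ⟨ψ, hψ, -, hev⟩ := exists_implicitFunction h0 (eval_derivative_ne_zero hQ hes h0)
  refine (hψ.differentiableAt.comp s he).congr_of_eventuallyEq ?_
  have hlim : Tendsto (fun t => (e t, f t)) (𝓝 s) (𝓝 (e s, f s)) :=
    he.continuousAt.prodMk hf
  filter_upwards [hroot, hlim.eventually hev] with t h1 h2
  exact (h2.1 h1).symm

/-- The roots over a punctured disc, pulled back to a half plane by the exponential map, are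
single-valued analytic functions. They are permuted by the translation by `2πi`, hence are
periodic. -/
theorem exists_roots_on_halfPlane {Q : ℂ[X][X]} (hQ : Q.Monic) {E₀ : ℂ} {r : ℝ}
    (hr : ∀ E, E ≠ E₀ → dist E E₀ < Real.exp r → E ∈ simpleLocus Q) :
    ∃ f : Fin Q.natDegree → ℂ → ℂ, (∀ i s, s.re < r → DifferentiableAt ℂ (f i) s) ∧
      (∀ s, s.re < r → (fiber Q (E₀ + Complex.exp s)).roots =
        Finset.univ.val.map fun i => f i s) ∧
      ∀ i, Function.Periodic (f i) ((Q.natDegree.factorial : ℂ) * (2 * Real.pi * Complex.I)) := by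
  let H : Set ℂ := {s | s.re < r}
  have hHconv : Convex ℝ H := convex_halfSpace_re_lt r
  have hHopen : IsOpen H := isOpen_lt Complex.continuous_re continuous_const
  let s₀ : H := ⟨((r - 1 : ℝ) : ℂ), by
    change Complex.re ((r - 1 : ℝ) : ℂ) < r
    rw [Complex.ofReal_re]; linarith⟩
  have : ContractibleSpace H := hHconv.contractibleSpace ⟨_, s₀.2⟩
  have : LocallyPathConnectedSpace H := hHopen.locallyPathConnectedSpace
  let e : C(H, ℂ) := ⟨fun s => E₀ + Complex.exp s, by fun_prop⟩
  have heS : ∀ s, e s ∈ simpleLocus Q := by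
    intro s
    refine hr _ (by simp [e, Complex.exp_ne_zero]) ?_
    simp only [e, ContinuousMap.coe_mk, dist_eq_norm, add_sub_cancel_left, Complex.norm_exp]
    exact Real.exp_lt_exp.2 s.2
  have hcov := isCoveringMapOn_proj hQ
  obtain ⟨z, hzinj, hz⟩ := exists_injective_roots hQ (heS s₀)
  have hex := fun i => (hcov.existsUnique_continuousMap_lifts e (a₀ := s₀)
    (e₀ := ⟨(e s₀, z i), hz i⟩) rfl heS).exists
  choose G hG0 hG using hex
  -- lifts that agree at one point are equal
  have huniq : ∀ {G₁ G₂ : C(H, curve Q)} (s : H), proj Q ∘ G₁ = e → proj Q ∘ G₂ = e →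
      G₁ s = G₂ s → G₁ = G₂ := fun {G₁ G₂} s h1 h2 h =>
    (hcov.existsUnique_continuousMap_lifts e (a₀ := s) (e₀ := G₁ s) (congrFun h1 s) heS).unique
      ⟨rfl, h1⟩ ⟨h.symm, h2⟩
  have hproj : ∀ i s, (G i s).1.1 = e s := fun i s => congrFun (hG i) s
  have hroot : ∀ i s, (fiber Q (e s)).eval (G i s).1.2 = 0 := fun i s => by
    rw [← hproj i s]; exact (G i s).2
  have hinj : ∀ s, Function.Injective fun i => (G i s).1.2 := by
    intro s i j hij
    have h1 : G i s = G j s := Subtype.ext (Prod.ext ((hproj i s).trans (hproj j s).symm) hij)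
    have h2 := huniq s (hG i) (hG j) h1
    apply hzinj
    have h3 : G i s₀ = G j s₀ := by rw [h2]
    rw [hG0, hG0] at h3
    simpa using congrArg (fun x : curve Q => x.1.2) h3
  have hroots : ∀ s, (fiber Q (e s)).roots = Finset.univ.val.map fun i => (G i s).1.2 :=
    fun s => roots_fiber_eq_map hQ (hinj s) fun i => hroot i s
  -- translations of the half plane by multiples of `2πi`
  let c : ℂ := 2 * Real.pi * Complex.I
  have hcre : ∀ m : ℕ, ∀ s : ℂ, (s + m * c).re = s.re := by intro m s; simp [c]
  let τ (m : ℕ) : C(H, H) := ⟨fun s => ⟨s + m * c, by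
    change Complex.re _ < r; rw [hcre]; exact s.2⟩, by fun_prop⟩
  have heτ : ∀ m s, e (τ m s) = e s := by
    intro m s
    simp only [e, τ, c, ContinuousMap.coe_mk]
    rw [Complex.exp_add, Complex.exp_nat_mul_two_pi_mul_I, mul_one]
  have hper : ∀ i, ∃ d : ℕ, 0 < d ∧ d ≤ Q.natDegree ∧ ∀ s, (G i (τ d s)).1.2 = (G i s).1.2 := by
    intro i
    have hex : ∀ m : Fin (Q.natDegree + 1), ∃ j, (G j s₀).1.2 = (G i (τ m s₀)).1.2 := by
      intro m
      have h1 := hroot i (τ m s₀)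
      rw [heτ, ← mem_roots_fiber hQ, hroots s₀] at h1
      obtain ⟨j, -, hj⟩ := Multiset.mem_map.1 h1
      exact ⟨j, hj⟩
    choose σ hσ using hex
    -- by the pigeonhole principle, two translates of a lift pass through the same root over `s₀`
    obtain ⟨m₁, m₂, hlt, hm⟩ : ∃ m₁ m₂, m₁ < m₂ ∧ σ m₁ = σ m₂ := by
      obtain ⟨a, b, hab, h⟩ := Fintype.exists_ne_map_eq_of_card_lt σ (by simp)
      rcases lt_or_gt_of_ne hab with h' | h'
      · exact ⟨a, b, h', h⟩
      · exact ⟨b, a, h', h.symm⟩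
    have hlt' : (m₁ : ℕ) < m₂ := hlt
    have hliftτ : ∀ m, proj Q ∘ ((G i).comp (τ m)) = e := fun m => by
      ext s
      exact (hproj i (τ m s)).trans (heτ m s)
    have heq : (G i).comp (τ m₁) = (G i).comp (τ m₂) := by
      refine huniq s₀ (hliftτ _) (hliftτ _) (Subtype.ext (Prod.ext ?_ ?_))
      · exact (congrFun (hliftτ m₁) s₀).trans (congrFun (hliftτ m₂) s₀).symm
      · have h1 := (hσ m₁).symm
        rw [hm] at h1
        exact h1.trans (hσ m₂)
    refine ⟨m₂ - m₁, by omega, by omega, fun s => ?_⟩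
    have hback : ∀ s : H, ∃ t : H, τ m₁ t = s := fun s => by
      refine ⟨⟨s - m₁ * c, ?_⟩, Subtype.ext (by simp [τ])⟩
      change Complex.re _ < r
      rw [← hcre m₁, sub_add_cancel]
      exact s.2
    obtain ⟨t, rfl⟩ := hback s
    have h1 : τ (m₂ - m₁) (τ m₁ t) = τ m₂ t := by
      refine Subtype.ext ?_
      simp only [τ, ContinuousMap.coe_mk]
      rw [Nat.cast_sub hlt'.le]; ring
    rw [h1]
    exact congrArg (fun g : C(H, curve Q) => (g t).1.2) heq.symm
  classical
  -- the half plane is invariant under the translations, so extension by zero keeps periodicity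
  let f (i : Fin Q.natDegree) (s : ℂ) : ℂ := if h : s ∈ H then (G i ⟨s, h⟩).1.2 else 0
  have hf : ∀ i (s : H), f i s = (G i s).1.2 := fun i s => by simp [f, s.2]
  refine ⟨f, fun i s hs => ?_, fun s hs => ?_, fun i => ?_⟩
  · refine differentiableAt_of_continuousAt_root hQ (e := fun s => E₀ + Complex.exp s)
      (by fun_prop) (heS ⟨s, hs⟩) ?_ ?_
    · have h1 : ContinuousOn (f i) H := by
        rw [continuousOn_iff_continuous_domRestrict]
        have : H.domRestrict (f i) = fun s => (G i s).1.2 := funext fun s => hf i s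
        rw [this]
        fun_prop
      exact h1.continuousAt (hHopen.mem_nhds hs)
    · filter_upwards [hHopen.mem_nhds hs] with t ht
      rw [hf i ⟨t, ht⟩]
      exact hroot i ⟨t, ht⟩
  · have := hroots ⟨s, hs⟩
    simp only [← hf] at this
    exact this
  · obtain ⟨d, hd, hdn, hdG⟩ := hper i
    have h1 : Function.Periodic (f i) (d * c) := by
      intro s
      by_cases hs : s ∈ H
      · have h2 := hdG ⟨s, hs⟩
        rw [← hf, ← hf] at h2
        exact h2
      · have hs' : s + d * c ∉ H := by
          intro h
          apply hs
          change Complex.re _ < r at h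
          rwa [hcre] at h
        simp [f, hs, hs']
    obtain ⟨q, hq⟩ := Nat.dvd_factorial hd hdn
    have h2 : ((Q.natDegree.factorial : ℕ) : ℂ) * (2 * Real.pi * Complex.I) = q * (d * c) := by
      rw [hq, Nat.cast_mul, mul_left_comm, mul_assoc]
      simp only [c]
      ring
    rw [h2]
    exact h1.nat_mul q

/-- **Puiseux's theorem**: near a point over which the roots of nearby fibres are simple, the roots
of a monic bivariate polynomial are analytic functions of an `N`-th root of the first variable. -/
theorem exists_analytic_roots_comp_pow {Q : ℂ[X][X]} (hQ : Q.Monic) {E₀ : ℂ}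
    (hE₀ : ∀ᶠ E in 𝓝[≠] E₀, E ∈ simpleLocus Q) :
    ∃ N : ℕ, N ≠ 0 ∧ ∃ F : Fin Q.natDegree → ℂ → ℂ, (∀ i, AnalyticAt ℂ (F i) 0) ∧
      ∀ᶠ w in 𝓝 0, (fiber Q (E₀ + w ^ N)).roots = Finset.univ.val.map fun i => F i w := by
  obtain ⟨R, hR, hball⟩ := Metric.eventually_nhds_iff.1 (eventually_nhdsWithin_iff.1 hE₀)
  obtain ⟨f, hfd, hfroots, hfper⟩ := exists_roots_on_halfPlane hQ (E₀ := E₀) (r := Real.log R)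
    fun E hne hE => hball (by rwa [Real.exp_log hR] at hE) hne
  set N := Q.natDegree.factorial
  have hN : N ≠ 0 := Nat.factorial_ne_zero _
  obtain ⟨ρ, hρ, hρR⟩ : ∃ ρ > 0, ∀ w : ℂ, ‖w‖ < ρ → ‖w ^ N‖ < R := by
    have h1 : ContinuousAt (fun w : ℂ => ‖w ^ N‖) 0 := by fun_prop
    have h2 : ∀ᶠ w in 𝓝 (0 : ℂ), ‖w ^ N‖ < R :=
      h1.eventually_lt continuousAt_const (by simpa [hN] using hR)
    obtain ⟨ρ, hρ, h⟩ := Metric.eventually_nhds_iff.1 h2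
    exact ⟨ρ, hρ, fun w hw => h (by simpa using hw)⟩
  -- any branch of the logarithm of `w` gives the same values
  have hkey : ∀ w l : ℂ, ‖w‖ < ρ → Complex.exp l = w →
      (N * l).re < Real.log R ∧ Complex.exp (N * l) = w ^ N := by
    rintro w l hw rfl
    refine ⟨?_, Complex.exp_nat_mul l N⟩
    rw [Real.lt_log_iff_exp_lt hR, ← Complex.norm_exp, Complex.exp_nat_mul]
    exact hρR _ hw
  let F (i : Fin Q.natDegree) (w : ℂ) : ℂ := f i (N * Complex.log w)
  have hFl : ∀ i (w l : ℂ), Complex.exp l = w → F i w = f i (N * l) := by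
    rintro i w l rfl
    obtain ⟨m, hm⟩ := Complex.exp_eq_exp_iff_exists_int.1
      (Complex.exp_log (Complex.exp_ne_zero l))
    simp only [F]
    rw [hm, mul_add, ← mul_assoc, mul_comm (N : ℂ) (m : ℂ), mul_assoc (m : ℂ)]
    exact (hfper i).int_mul m _
  have hFroots : ∀ w : ℂ, ‖w‖ < ρ → w ≠ 0 →
      (fiber Q (E₀ + w ^ N)).roots = Finset.univ.val.map fun i => F i w := by
    intro w hw hw0
    obtain ⟨h1, h2⟩ := hkey w _ hw (Complex.exp_log hw0)
    rw [← h2]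
    exact hfroots _ h1
  have hFd : ∀ i, DifferentiableOn ℂ (F i) (Metric.ball 0 ρ \ {0}) := by
    rintro i w ⟨hw, hw0 : w ≠ 0⟩
    rw [mem_ball_zero_iff] at hw
    refine DifferentiableAt.differentiableWithinAt ?_
    -- a branch of the logarithm near `w`
    let l (v : ℂ) : ℂ := Complex.log (v / w) + Complex.log w
    have hl : DifferentiableAt ℂ l w :=
      ((differentiableAt_id.div_const w).clog (by simp [hw0])).add_const _
    have hlw : Complex.exp (l w) = w := by simp [l, hw0, Complex.exp_log]
    have h1 : DifferentiableAt ℂ (fun v => f i (N * l v)) w :=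
      DifferentiableAt.comp (g := f i) (f := fun v => N * l v) w
        (hfd i _ (hkey w _ hw hlw).1) (hl.const_mul _)
    refine h1.congr_of_eventuallyEq ?_
    filter_upwards [eventually_ne_nhds hw0] with v hv
    refine hFl i v (l v) ?_
    simp only [l]
    rw [Complex.exp_add, Complex.exp_log (div_ne_zero hv hw0), Complex.exp_log hw0,
      div_mul_cancel₀ _ hw0]
  have hFb : ∀ i, BddAbove (norm ∘ F i '' (Metric.ball 0 ρ \ {0})) := by
    intro i
    obtain ⟨C, hC⟩ := exists_root_bound hQ (isCompact_closedBall E₀ R)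
    refine ⟨C, ?_⟩
    rintro _ ⟨w, ⟨hw, hw0⟩, rfl⟩
    rw [mem_ball_zero_iff] at hw
    refine hC (E₀ + w ^ N) ?_ _ ?_
    · simpa using (hρR w hw).le
    · rw [← mem_roots_fiber hQ, hFroots w hw hw0]
      exact Multiset.mem_map_of_mem _ (Finset.mem_univ_val i)
  -- removing the singularity at the origin
  let F' (i : Fin Q.natDegree) : ℂ → ℂ := Function.update (F i) 0 (limUnder (𝓝[≠] 0) (F i))
  have hF'an : ∀ i, AnalyticAt ℂ (F' i) 0 := fun i =>
    (Complex.differentiableOn_update_limUnder_of_bddAbove (Metric.ball_mem_nhds 0 hρ) (hFd i)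
      (hFb i)).analyticAt (Metric.ball_mem_nhds 0 hρ)
  have hF'roots : ∀ w : ℂ, ‖w‖ < ρ → w ≠ 0 →
      (fiber Q (E₀ + w ^ N)).roots = Finset.univ.val.map fun i => F' i w := by
    intro w hw hw0
    rw [hFroots w hw hw0]
    simp only [F', Function.update_of_ne hw0]
  refine ⟨N, hN, F', hF'an, ?_⟩
  filter_upwards [Metric.ball_mem_nhds 0 hρ] with w hw
  rw [mem_ball_zero_iff] at hw
  by_cases hw0 : w = 0
  swap
  · exact hF'roots w hw hw0
  subst hw0
  -- at the centre, pass to the limit in the factorization into linear factors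
  have hfac : ∀ z, ∀ᶠ w in 𝓝[≠] (0 : ℂ),
      (fiber Q (E₀ + w ^ N)).eval z = ∏ i, (z - F' i w) := by
    intro z
    filter_upwards [eventually_nhdsWithin_of_eventually_nhds (Metric.ball_mem_nhds 0 hρ),
      self_mem_nhdsWithin] with w hw hw0
    rw [dist_zero_right] at hw
    have h1 := (IsAlgClosed.splits (fiber Q (E₀ + w ^ N))).eq_prod_roots_of_monic (hQ.map _)
    rw [hF'roots w hw hw0] at h1
    rw [h1, Multiset.map_map, eval_multiset_prod, Multiset.map_map]
    simp [Finset.prod]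
  have hlim : ∀ z, (fiber Q (E₀ + 0 ^ N)).eval z = ∏ i, (z - F' i 0) := by
    intro z
    have h1 : Continuous fun w : ℂ => (fiber Q (E₀ + w ^ N)).eval z :=
      (continuous_eval_fiber Q).comp (f := fun w : ℂ => (E₀ + w ^ N, z)) (by fun_prop)
    have h2 : ContinuousAt (fun w : ℂ => ∏ i, (z - F' i w)) 0 :=
      tendsto_finsetProd _ fun i _ => tendsto_const_nhds.sub (hF'an i).continuousAt
    exact tendsto_nhds_unique ((h1.continuousAt.tendsto.mono_left nhdsWithin_le_nhds).congr'
      (hfac z)) (h2.tendsto.mono_left nhdsWithin_le_nhds)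
  have hpoly : fiber Q (E₀ + 0 ^ N) =
      ((Finset.univ.val.map fun i => F' i 0).map fun a => X - C a).prod := by
    refine Polynomial.funext fun z => ?_
    rw [hlim, Multiset.map_map, eval_multiset_prod, Multiset.map_map]
    simp [Finset.prod]
  rw [hpoly, roots_multiset_prod_X_sub_C]

end BivariatePolynomial

/-! ### The spectrum of the transfer matrix -/

theorem exists_equiv_of_map_univ_eq {α β γ : Type*} [Fintype α] [Fintype β] {f : α → γ} {g : β → γ}
    (h : (Finset.univ : Finset α).val.map f = (Finset.univ : Finset β).val.map g) :
    ∃ e : α ≃ β, ∀ a, g (e a) = f a := by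
  classical
  have hcard : ∀ c, Fintype.card {a // f a = c} = Fintype.card {b // g b = c} := by
    intro c
    have := congrArg (Multiset.count c) h
    simp only [Multiset.count_map] at this
    rw [Fintype.card_subtype, Fintype.card_subtype]
    simpa [eq_comm, Finset.card_def] using this
  refine ⟨Equiv.ofFiberEquiv fun c => Fintype.equivOfCardEq (hcard c), fun a => ?_⟩
  exact Equiv.ofFiberEquiv_map _ a

/-- The middle moduli are equal exactly when no gap separates `L` of the moduli from the `L` larger
ones. Unlike the definition, this criterion does not need the values to be ordered. -/
theorem mem_middleModulusSet_iff {L : ℕ} (hL : 1 ≤ L) {R V T : Matrix (Fin L) (Fin L) ℂ} {E : ℂ}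
    {ι : Type*} [Fintype ι] {v : ι → ℂ}
    (hv : (transferMatrix R V T E).charpoly.roots = Finset.univ.val.map v) :
    E ∈ middleModulusSet R V T ↔ ¬ ∃ S : Finset ι, S.card = L ∧ HasGapAt v S := by
  classical
  have hcard : Fintype.card ι = 2 * L := by
    have h1 := congrArg Multiset.card hv
    rw [IsAlgClosed.card_roots_eq_natDegree, Matrix.charpoly_natDegree_eq_dim] at h1
    simp at h1
    omega
  constructor
  · rintro ⟨z, ⟨hz, hmono⟩, i, j, hi, hj, hij⟩ ⟨S, hS, hgap⟩
    obtain ⟨e, he⟩ := exists_equiv_of_map_univ_eq (hz.trans hv)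
    let S' := S.map e.symm.toEmbedding
    have hS' : S'.card = L := by rw [Finset.card_map, hS]
    have hmem : ∀ k, k ∈ S' ↔ e k ∈ S := by
      intro k
      simp only [S', Finset.mem_map_equiv, Equiv.symm_symm]
    -- the separated set is an initial segment, hence consists of the first `L` indices
    have hgap' : ∀ a ∈ S', ∀ b ∉ S', a < b := by
      intro a ha b hb
      by_contra! hab
      have h1 := hgap _ ((hmem a).1 ha) _ (fun h => hb ((hmem b).2 h))
      rw [he, he] at h1
      exact absurd (hmono hab) (not_le.2 h1)
    have hiS : i ∈ S' := by
      by_contra hiS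
      have h1 : S' ⊆ Finset.Iio i := fun a ha => Finset.mem_Iio.2 (hgap' a ha i hiS)
      have h2 := Finset.card_le_card h1
      rw [Fin.card_Iio] at h2
      omega
    have hjS : j ∉ S' := by
      intro hjS
      have h1 : S'ᶜ ⊆ Finset.Ioi j := fun b hb =>
        Finset.mem_Ioi.2 (hgap' j hjS b (Finset.mem_compl.1 hb))
      have h2 := Finset.card_le_card h1
      rw [Fin.card_Ioi, Finset.card_compl, Fintype.card_fin] at h2
      omega
    have h1 := hgap _ ((hmem i).1 hiS) _ (fun h => hjS ((hmem j).2 h))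
    rw [he, he] at h1
    exact h1.ne hij
  · intro hno
    let e : Fin (2 * L) ≃ ι := (Fintype.equivFinOfCardEq hcard).symm
    let σ := Tuple.sort fun k => ‖v (e k)‖
    have hmono : Monotone fun k => ‖v (e (σ k))‖ := Tuple.monotone_sort fun k => ‖v (e k)‖
    let i : Fin (2 * L) := ⟨L - 1, by omega⟩
    let j : Fin (2 * L) := ⟨L, by omega⟩
    refine ⟨fun k => v (e (σ k)), ⟨?_, hmono⟩, i, j, by simp only [i]; omega, rfl, ?_⟩
    · rw [hv, ← Multiset.map_univ_val_equiv (σ.trans e), Multiset.map_map]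
      rfl
    · by_contra hne
      have hlt : ‖v (e (σ i))‖ < ‖v (e (σ j))‖ :=
        lt_of_le_of_ne (hmono (by simp only [i, j, Fin.mk_le_mk]; omega)) hne
      refine hno ⟨(Finset.univ : Finset (Fin L)).map
        ((Fin.castLEEmb (by omega : L ≤ 2 * L)).trans (σ.trans e).toEmbedding), by simp, ?_⟩
      intro a ha b hb
      obtain ⟨k, -, rfl⟩ := Finset.mem_map.1 ha
      obtain ⟨m, rfl⟩ := (σ.trans e).surjective b
      have hm : L ≤ m := by
        by_contra! hm
        exact hb (Finset.mem_map.2 ⟨⟨m, hm⟩, Finset.mem_univ _, rfl⟩)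
      have hk : Fin.castLE (by omega) k ≤ i := by
        rw [Fin.le_def]
        simp only [i, Fin.val_castLE]
        omega
      exact (hmono hk).trans_lt (hlt.trans_le (hmono (show j ≤ m from hm)))

open Polynomial in
/-- The characteristic polynomial of the transfer matrix, as a bivariate polynomial. -/
def transferCharpoly {L : ℕ} (R V T : Matrix (Fin L) (Fin L) ℂ) : ℂ[X][X] :=
  (Matrix.fromBlocks (((X : ℂ[X]) • (1 : Matrix (Fin L) (Fin L) ℂ[X]) - V.map C) * T⁻¹.map C)
    ((-R).map C) (T⁻¹.map C) 0).charpoly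

open Polynomial in
theorem fiber_transferCharpoly {L : ℕ} (R V T : Matrix (Fin L) (Fin L) ℂ) (E : ℂ) :
    BivariatePolynomial.fiber (transferCharpoly R V T) E = (transferMatrix R V T E).charpoly := by
  rw [BivariatePolynomial.fiber, transferCharpoly, ← Matrix.charpoly_map]
  congr 1
  rw [transferMatrix, Matrix.fromBlocks_map]
  have hC : ∀ A : Matrix (Fin L) (Fin L) ℂ, (A.map C).map (evalRingHom E) = A := by
    intro A; ext; simp
  congr 1
  · rw [Matrix.map_mul, hC]
    congr 1
    ext a b
    by_cases hab : a = b <;> simp [hab]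
  · exact hC _
  · exact hC _
  · ext; simp

theorem transferMatrix_det_ne_zero {L : ℕ} {R V T : Matrix (Fin L) (Fin L) ℂ} (hR : IsUnit R)
    (hT : IsUnit T) (E : ℂ) : (transferMatrix R V T E).det ≠ 0 := by
  intro h
  obtain ⟨x, hx, hx0⟩ := Matrix.exists_mulVec_eq_zero_iff.2 h
  rw [transferMatrix, Matrix.fromBlocks_mulVec] at hx0
  have hinj : ∀ {A : Matrix (Fin L) (Fin L) ℂ} {y : Fin L → ℂ}, IsUnit A → A.mulVec y = 0 →
      y = 0 := fun {A y} hA hy => by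
    by_contra hne
    exact ((Matrix.isUnit_iff_isUnit_det A).1 hA).ne_zero
      (Matrix.exists_mulVec_eq_zero_iff.1 ⟨y, hne, hy⟩)
  have h1 : x ∘ Sum.inl = 0 := by
    refine hinj (Matrix.isUnit_nonsing_inv_iff.2 hT) (A := T⁻¹) ?_
    ext a
    simpa using congrFun hx0 (Sum.inr a)
  have h2 : x ∘ Sum.inr = 0 := by
    refine hinj hR ?_
    ext a
    have := congrFun hx0 (Sum.inl a)
    simpa [h1, Matrix.neg_mulVec] using this
  apply hx
  ext (a | a)
  · exact congrFun h1 a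
  · exact congrFun h2 a

/-! ### Analytic arcs in the energy plane -/

/-- The modulus of a conformal germ is strictly increasing along small positive reals. -/
theorem IsConformalGerm.eventually_strictMonoOn_norm {Ψ : ℂ → ℂ} (hΨ : IsConformalGerm Ψ) :
    ∀ᶠ ε : ℝ in 𝓝[>] 0, StrictMonoOn (fun t : ℝ => ‖Ψ t‖ ^ 2) (Icc 0 ε) := by
  have hd : ContinuousAt (dslope Ψ 0) 0 :=
    continuousAt_dslope_same.2 hΨ.analyticAt.differentiableAt
  have hin : ∀ᶠ u in 𝓝 (0 : ℂ), AnalyticAt ℂ Ψ u ∧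
      0 < inner ℝ (dslope Ψ 0 u) (deriv Ψ u) := by
    refine hΨ.analyticAt.eventually_analyticAt.and ?_
    have h1 : ContinuousAt (fun u => inner ℝ (dslope Ψ 0 u) (deriv Ψ u)) 0 :=
      ContinuousAt.inner hd hΨ.analyticAt.deriv.continuousAt
    refine continuousAt_const.eventually_lt h1 ?_
    rw [dslope_same]
    exact real_inner_self_pos.2 hΨ.deriv_ne_zero
  obtain ⟨r, hr, hball⟩ := Metric.eventually_nhds_iff.1 hin
  filter_upwards [Ioo_mem_nhdsGT hr] with ε hε
  have hmem : ∀ t ∈ Icc 0 ε, dist (t : ℂ) 0 < r := by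
    intro t ht
    simpa [abs_of_nonneg ht.1] using ht.2.trans_lt hε.2
  have hder : ∀ t ∈ Icc 0 ε, HasDerivAt (fun t : ℝ => ‖Ψ t‖ ^ 2)
      (2 * inner ℝ (Ψ t) (deriv Ψ t)) t := fun t ht =>
    ((hball (hmem t ht)).1.differentiableAt.hasDerivAt.comp_ofReal).norm_sq
  refine strictMonoOn_of_deriv_pos (convex_Icc _ _)
    (fun t ht => (hder t ht).continuousAt.continuousWithinAt) fun t ht => ?_
  rw [interior_Icc] at ht
  have ht' : t ∈ Icc 0 ε := Ioo_subset_Icc_self ht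
  rw [(hder t ht').deriv]
  have h1 : Ψ t = t • dslope Ψ 0 t := by
    have := sub_smul_dslope Ψ 0 (t : ℂ)
    rw [hΨ.map_zero, sub_zero, sub_zero] at this
    rw [← this, Complex.real_smul, smul_eq_mul]
  rw [h1, real_inner_smul_left]
  have := (hball (hmem t ht')).2
  have := ht.1
  positivity

/-- Small initial pieces of the image of a conformal arc under a branched covering are analytic
arcs. Injectivity holds since the modulus increases along the arc; the derivative may vanish at the
branch point only. -/
theorem IsConformalGerm.eventually_isAnalyticArc {Ψ : ℂ → ℂ} (hΨ : IsConformalGerm Ψ) (E₀ : ℂ)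
    {N : ℕ} (hN : N ≠ 0) :
    ∀ᶠ ε : ℝ in 𝓝[>] 0, IsAnalyticArc ((fun t : ℝ => E₀ + Ψ t ^ N) '' Icc 0 ε) := by
  have hev : ∀ᶠ u in 𝓝 (0 : ℂ), AnalyticAt ℂ Ψ u ∧ deriv Ψ u ≠ 0 :=
    hΨ.analyticAt.eventually_analyticAt.and
      (hΨ.analyticAt.deriv.continuousAt.eventually_ne hΨ.deriv_ne_zero)
  obtain ⟨r, hr, hball⟩ := Metric.eventually_nhds_iff.1 hev
  filter_upwards [Ioo_mem_nhdsGT hr, hΨ.eventually_strictMonoOn_norm] with ε hε hmono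
  have hmem : ∀ t ∈ Icc 0 ε, dist (t : ℂ) 0 < r := by
    intro t ht
    simpa [abs_of_nonneg ht.1] using ht.2.trans_lt hε.2
  have hscale : ∀ t ∈ Icc (0 : ℝ) 1, ε * t ∈ Icc 0 ε := fun t ht =>
    ⟨mul_nonneg hε.1.le ht.1, mul_le_of_le_one_right hε.1.le ht.2⟩
  refine ⟨fun t => E₀ + Ψ ((ε * t : ℝ) : ℂ) ^ N, fun t ht => ?_, fun s hs t ht hst => ?_,
    fun t ht => ?_, ?_⟩
  · have h1 : AnalyticAt ℝ (fun u : ℂ => E₀ + Ψ u ^ N) ((ε * t : ℝ) : ℂ) :=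
      (analyticAt_const.add ((hball (hmem _ (hscale t ht))).1.pow N)).restrictScalars
    have h2 : AnalyticAt ℝ (fun t : ℝ => ((ε * t : ℝ) : ℂ)) t :=
      (Complex.ofRealCLM.analyticAt _).fun_comp (analyticAt_const.mul analyticAt_id)
    exact h1.comp (f := fun t : ℝ => ((ε * t : ℝ) : ℂ)) h2
  · have h1 : ‖Ψ ((ε * s : ℝ) : ℂ)‖ ^ N = ‖Ψ ((ε * t : ℝ) : ℂ)‖ ^ N := by
      rw [← norm_pow, ← norm_pow, add_left_cancel hst]
    have h2 := (pow_left_inj₀ (norm_nonneg _) (norm_nonneg _) hN).1 h1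
    have h3 := hmono.injOn (hscale s hs) (hscale t ht) (by simp only [h2])
    exact mul_left_cancel₀ hε.1.ne' h3
  · have ht' := hscale t (Ioo_subset_Icc_self ht)
    have hpos : 0 < ε * t := mul_pos hε.1 ht.1
    have hne : Ψ ((ε * t : ℝ) : ℂ) ≠ 0 := by
      intro h0
      have := hmono ⟨le_rfl, hε.1.le⟩ ht' hpos
      simp only [Complex.ofReal_zero, hΨ.map_zero, h0] at this
      exact lt_irrefl _ this
    obtain ⟨h1, h2⟩ := hball (hmem _ ht')
    have h3 : HasDerivAt (fun u : ℂ => E₀ + Ψ u ^ N) _ ((ε * t : ℝ) : ℂ) :=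
      (h1.differentiableAt.hasDerivAt.fun_pow N).const_add E₀
    have h4 := h3.comp_ofReal.scomp t ((hasDerivAt_id t).const_mul ε)
    rw [show (fun t : ℝ => E₀ + Ψ ((ε * t : ℝ) : ℂ) ^ N) =
      (fun y : ℝ => E₀ + Ψ (y : ℂ) ^ N) ∘ HMul.hMul ε from rfl, h4.deriv]
    refine smul_ne_zero (by simpa using hε.1.ne') ?_
    exact mul_ne_zero (mul_ne_zero (by exact_mod_cast hN) (pow_ne_zero _ hne)) h2
  · rw [show (fun t : ℝ => E₀ + Ψ ((ε * t : ℝ) : ℂ) ^ N) =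
      (fun y : ℝ => E₀ + Ψ (y : ℂ) ^ N) ∘ fun y => ε * y from rfl, image_comp,
      image_mul_left_Icc' hε.1, mul_zero, mul_one]

/-- It suffices to cover `S` near each point by finitely many small arcs contained in `S`: the
required neighbourhood is the union of these arcs with the complement of `S`. -/
theorem isLocallyFiniteUnionOfAnalyticArcs_of_cover {S : Set ℂ}
    (h : ∀ x ∈ S, ∀ U ∈ 𝓝 x, ∃ 𝒜 : Set (Set ℂ), 𝒜.Finite ∧
      (∀ A ∈ 𝒜, IsAnalyticArc A ∧ A ⊆ S ∩ U) ∧ ∀ᶠ y in 𝓝 x, y ∈ S → y ∈ ⋃₀ 𝒜) :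
    IsLocallyFiniteUnionOfAnalyticArcs S := by
  intro x hx U hU
  obtain ⟨𝒜, hfin, harc, hcov⟩ := h x hx U hU
  have hsub : ⋃₀ 𝒜 ⊆ S ∩ U := sUnion_subset fun A hA => (harc A hA).2
  refine ⟨(U \ S) ∪ ⋃₀ 𝒜, ?_, union_subset sdiff_subset fun y hy => (hsub hy).2, 𝒜, hfin,
    fun A hA => (harc A hA).1, ?_⟩
  · filter_upwards [hU, hcov] with y h1 h2
    by_cases hy : y ∈ S
    · exact .inr (h2 hy)
    · exact .inl ⟨h1, hy⟩
  · ext y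
    constructor
    · rintro ⟨h1, h2 | h2⟩
      · exact absurd h1 h2.2
      · exact h2
    · intro hy
      exact ⟨(hsub hy).1, .inr hy⟩

theorem isOpenMap_const_add_pow (E₀ : ℂ) {N : ℕ} (hN : N ≠ 0) :
    IsOpenMap fun w : ℂ => E₀ + w ^ N := by
  have han : AnalyticOnNhd ℂ (fun w : ℂ => E₀ + w ^ N) univ := fun w _ =>
    analyticAt_const.add (analyticAt_id.pow N)
  rcases han.is_constant_or_isOpen isPreconnected_univ with ⟨c, hc⟩ | h
  · have h0 := (hc 0 trivial).trans (hc 1 trivial).symm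
    simp [hN] at h0
  · exact fun s hs => h s (subset_univ s) hs

theorem mainTheorem8 (L : ℕ) (hL : 1 ≤ L) (R V T : Matrix (Fin L) (Fin L) ℂ)
    (hR : IsUnit R) (hT : IsUnit T) (hF : (degenerateEnergies R V T).Finite) :
    IsLocallyFiniteUnionOfAnalyticArcs (frontier (middleModulusSet R V T)) := by
  refine isLocallyFiniteUnionOfAnalyticArcs_of_cover fun E₀ hE₀ U hU => ?_
  set Λ := middleModulusSet R V T
  set Q := transferCharpoly R V T
  have hQ : Q.Monic := Matrix.charpoly_monic _
  have hsimple : ∀ᶠ E in 𝓝[≠] E₀, E ∈ BivariatePolynomial.simpleLocus Q := by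
    rw [eventually_nhdsWithin_iff]
    filter_upwards [(hF.subset sdiff_subset).isClosed.isOpen_compl.mem_nhds
      (show E₀ ∈ (degenerateEnergies R V T \ {E₀})ᶜ from fun h => h.2 rfl)] with E h1 h2 z
    rw [fiber_transferCharpoly]
    by_contra! h3
    exact h1 ⟨⟨z, h3⟩, h2⟩
  obtain ⟨N, hN, F, hFan, hFroots⟩ := BivariatePolynomial.exists_analytic_roots_comp_pow hQ hsimple
  simp only [Q, fiber_transferCharpoly] at hFroots
  have hF0 : ∀ i, F i 0 ≠ 0 := by
    intro i h0
    have h1 := hFroots.self_of_nhds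
    have h2 : (0 : ℂ) ∈ (transferMatrix R V T (E₀ + 0 ^ N)).charpoly.roots := by
      rw [h1]
      exact Multiset.mem_map.2 ⟨i, Finset.mem_univ_val i, h0⟩
    have h3 := Polynomial.isRoot_of_mem_roots h2
    rw [Polynomial.IsRoot, Matrix.eval_charpoly, map_zero, zero_sub, Matrix.det_neg] at h3
    exact transferMatrix_det_ne_zero hR hT _ ((mul_eq_zero.1 h3).resolve_left (by simp))
  -- pull `Λ` back along the branched covering `q`, which is open and so respects frontiers
  let q (w : ℂ) : ℂ := E₀ + w ^ N
  have hq0 : q 0 = E₀ := by simp [q, hN]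
  have hqc : Continuous q := by fun_prop
  have hqo : IsOpenMap q := isOpenMap_const_add_pow E₀ hN
  have hpre := hqo.preimage_frontier_eq_frontier_preimage hqc Λ
  have hmem : ∀ w, w ∈ frontier (q ⁻¹' Λ) ↔ q w ∈ frontier Λ := fun w => by rw [← hpre]; rfl
  obtain ⟨P, hPfin, ⟨Ψ₀, hΨ₀⟩, hPon, hPcov⟩ :=
    isFiniteUnionOfConformalArcsAtZero_frontier_of_gap hFan hF0 L (M := q ⁻¹' Λ)
      (hFroots.mono fun w hw => by
        rw [mem_preimage, mem_middleModulusSet_iff hL hw, not_not])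
      ((hmem 0).2 (by rwa [hq0]))
  have hsmall : ∀ Ψ ∈ P, ∀ᶠ ε : ℝ in 𝓝[>] 0, IsAnalyticArc ((fun t : ℝ => q (Ψ t)) '' Icc 0 ε) ∧
      (fun t : ℝ => q (Ψ t)) '' Icc 0 ε ⊆ frontier Λ ∩ U := by
    intro Ψ hΨ
    obtain ⟨hconf, hon⟩ := hPon Ψ hΨ
    have hcont : ContinuousAt (fun t : ℝ => q (Ψ t)) 0 :=
      hqc.continuousAt.comp (ContinuousAt.comp (by simpa using hconf.analyticAt.continuousAt)
        Complex.continuous_ofReal.continuousAt)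
    have hval : q (Ψ ((0 : ℝ) : ℂ)) = E₀ := by rw [Complex.ofReal_zero, hconf.map_zero, hq0]
    obtain ⟨e₁, he₁, hUe⟩ := Metric.eventually_nhds_iff.1
      (hcont.eventually_mem (by simpa only [hval] using hU))
    obtain ⟨e₂, he₂, hone⟩ := mem_nhdsGT_iff_exists_Ioo_subset.1 hon
    filter_upwards [hconf.eventually_isAnalyticArc E₀ hN, Ioo_mem_nhdsGT he₁,
      Ioo_mem_nhdsGT he₂] with ε h1 h2 h3
    refine ⟨h1, ?_⟩
    rintro _ ⟨t, ht, rfl⟩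
    refine ⟨?_, hUe (by simpa [abs_of_nonneg ht.1] using ht.2.trans_lt h2.2)⟩
    rcases ht.1.eq_or_lt with rfl | hpos
    · simpa only [hval] using hE₀
    · exact (hmem _).1 (hone ⟨hpos, ht.2.trans_lt h3.2⟩)
  obtain ⟨ε, hε, hε0⟩ := (((eventually_all_finite hPfin).2 hsmall).and
    (self_mem_nhdsWithin : Ioi (0 : ℝ) ∈ 𝓝[>] 0)).exists
  refine ⟨(fun Ψ : ℂ → ℂ => (fun t : ℝ => q (Ψ t)) '' Icc 0 ε) '' P, hPfin.image _, ?_, ?_⟩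
  · rintro _ ⟨Ψ, hΨ, rfl⟩
    exact hε Ψ hΨ
  · have hev : ∀ᶠ w in 𝓝 0, q w ∈ frontier Λ →
        q w ∈ ⋃₀ ((fun Ψ : ℂ → ℂ => (fun t : ℝ => q (Ψ t)) '' Icc 0 ε) '' P) := by
      filter_upwards [eventually_nhdsWithin_iff.1 (hPcov ε hε0)] with w hw hwΛ
      by_cases hw0 : w = 0
      · refine ⟨_, ⟨Ψ₀, hΨ₀, rfl⟩, 0, ⟨le_rfl, le_of_lt hε0⟩, ?_⟩
        simp only [Complex.ofReal_zero]
        rw [(hPon Ψ₀ hΨ₀).1.map_zero, hw0]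
      · obtain ⟨Ψ, hΨ, t, ht, rfl⟩ := hw hw0 ((hmem w).2 hwΛ)
        exact ⟨_, ⟨Ψ, hΨ, rfl⟩, t, Ioo_subset_Icc_self ht, rfl⟩
    have hle := hqo.nhds_le 0
    rw [hq0] at hle
    exact hle (mem_map.2 hev)

end
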